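/- Let $\mathbb{T}=\mathbb{R}/\mathbb{Z}$ with Lebesgue (probability) measure $|\cdot|$, and for $f\in L^1(\mathbb{T})$ let $\widehat f(t)=\int_{\mathbb{T}} f(x)e^{-2\pi i t x}\,dx$, $t\in\mathbb{Z}$. Let $m:\mathbb{R}\to\mathbb{C}$ be a Marcinkiewicz multiplier, that is, $m$ is bounded on $\mathbb{R}$, is $C^\infty$ on $\mathbb{R}\setminus\{0\}$, and there is a constant $A$ with $|m^{(l)}(t)|\le A|t|^{-l}$ for all $t\neq 0$ and $0\le l\le 4$. For $f\in L^1(\mathbb{T})$ put $$\Lambda_m f(x)=\sum_{t\in\mathbb{Z}} m(t)\,\widehat f(t)\,e^{2\pi i t x},$$ where the sum is the limit in measure on $\mathbb{T}$ of the symmetric partial sums $\sum_{|t|\le N}$ as $N\to\infty$. Then this limit exists for every $f\in L^1(\mathbb{T})$, and $\Lambda_m$ maps $L^1(\mathbb{T})$ boundedly to $L^{1,\infty}(\mathbb{T})$ and $L^p(\mathbb{T})$ boundedly to $L^p(\mathbb{T})$ for every $1<p<\infty$. That is, there is a constant $C$ (depending on $m$) such that $$\|\Lambda_m f\|_{1,\infty}:=\sup_{\lambda>0}\lambda\,\bigl|\{x\in\mathbb{T}:|\Lambda_m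 f(x)|>\lambda\}\bigr|\le C\|f\|_1\qquad\text{for all } f\in L^1(\mathbb{T}),$$ and for every $1<p<\infty$ there is a constant $C_p$ (depending on $m$ and $p$) such that $$\|\Lambda_m f\|_p\le C_p\|f\|_p\qquad\text{for all } f\in L^p(\mathbb{T}).$$ -/

import Mathlib

open MeasureTheory Filter
open scoped ENNReal NNReal ContDiff

/-- `m : ℝ → ℂ` is a Marcinkiewicz multiplier: it is smooth away from `0`, bounded everywhere
(the value at `0` included), and `|m^{(l)}(t)| ≲ |t|^{-l}` for `t ≠ 0` and `0 ≤ l ≤ 4`. -/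
structure IsMarcinkiewiczMultiplier (m : ℝ → ℂ) : Prop where
  smooth : ContDiffOn ℝ ∞ m {0}ᶜ
  bounded : ∃ B : ℝ, ∀ t : ℝ, ‖m t‖ ≤ B
  deriv_bound : ∃ C : ℝ, ∀ l : ℕ, l ≤ 4 → ∀ t : ℝ, t ≠ 0 →
    ‖iteratedDeriv l m t‖ ≤ C / |t| ^ l

/-- The symmetric partial sum `∑_{|t| ≤ N} m(t) f̂(t) e^{2πitx}` on the circle `ℝ/ℤ`. -/
noncomputable def multiplierPartialSum (m : ℝ → ℂ) (f : UnitAddCircle → ℂ) (N : ℕ)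
    (x : UnitAddCircle) : ℂ :=
  ∑ t ∈ Finset.Icc (-(N : ℤ)) (N : ℤ), m (t : ℝ) * fourierCoeff f t * fourier t x

/-- `g` is the sum of the series `∑_{t ∈ ℤ} m(t) f̂(t) e^{2πitx}`: the symmetric partial sums
converge to `g` in (Lebesgue) measure on the circle. Such a `g` is unique up to null sets. -/
structure IsMultiplierSeriesSum (m : ℝ → ℂ) (f g : UnitAddCircle → ℂ) : Prop where
  aestronglyMeasurable : AEStronglyMeasurable g volume
  tendsto : TendstoInMeasure volume (multiplierPartialSum m f) atTop g

open Classical in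
/-- The multiplier operator `Λ_m f(x) = ∑_{t ∈ ℤ} m(t) f̂(t) e^{2πitx}` (defined up to null sets;
the value is `0` if the series does not converge in measure). -/
noncomputable def multiplierOperator (m : ℝ → ℂ) (f : UnitAddCircle → ℂ) : UnitAddCircle → ℂ :=
  if h : ∃ g, IsMultiplierSeriesSum m f g then h.choose else 0

/-- The weak-`L^p` quasi-norm `sup_{s > 0} s |{x : |f(x)| > s}|^{1/p}` on the circle. -/
noncomputable def weakLpNorm (f : UnitAddCircle → ℂ) (p : ℝ) : ℝ≥0∞ :=
  ⨆ (s : ℝ≥0) (_ : 0 < s), (s : ℝ≥0∞) * (volume {x : UnitAddCircle | s < ‖f x‖₊}) ^ (1 / p)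

open scoped ComplexConjugate Topology

/-! Everything rests on bounds, uniform in `N`, for the partial sum operators. These have finitely
supported coefficients, so their kernels are trigonometric polynomials. By the mean value theorem
the samples a(t) = m(t) are bounded and satisfy |t||a(t+1) - a(t)| ≤ A (`IsDiscreteMarcinkiewicz`),
and this first-order condition drives a Calderón–Zygmund argument.

Coefficients satisfying the condition are cut into dyadic frequency bumps. For a bump at frequency
M, Parseval applied to the coefficients and to their differences bounds the L² norms of the kernel
k(x) and of ‖x‖k(x). Cauchy–Schwarz then gives an L¹ norm O(A) and an L¹ tail O(A/√(Mr)) outside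
radius r. Translation by h changes the kernel, far from 0, by O(A min(Mh, (Mh)^(-1/2))) in L¹.
Summing over dyadic M gives the Hörmander condition with a constant independent of the support.
Together with the L² bound and a stopping-time decomposition of f, this yields
`IsDiscreteMarcinkiewicz.weak_type_one_one`.

The sharp cutoff to |t| ≤ N does not preserve the condition: the jumps at ±N carry the weight N. The
cutoff is therefore written as a Fejér tent plus two ramps. Each ramp has a single jump, and
modulating f moves that jump next to frequency 0, where the weight is harmless. Modulation changes
no absolute values, so `IsDiscreteMarcinkiewicz.weak_type_partialSum` is uniform in `N`.

Interpolation with L² covers 1 < p < 2, and duality covers p > 2. The partial sums of a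
trigonometric polynomial are eventually constant, so density in L¹ and the uniform weak type bound
make the partial sums of any integrable f Cauchy in measure. The uniform bounds then pass to the
limit. -/

lemma haarAddCircle_eq_volume :
    (AddCircle.haarAddCircle : Measure UnitAddCircle) = volume := by
  simp [AddCircle.volume_eq_smul_haarAddCircle]

instance : IsProbabilityMeasure (volume : Measure UnitAddCircle) := by
  rw [← haarAddCircle_eq_volume]; infer_instance

/-! ### The norm on the circle and the size of characters. -/

lemma exists_real_representative (x : UnitAddCircle) :
    ∃ u : ℝ, x = (u : UnitAddCircle) ∧ |u| = ‖x‖ ∧ |u| ≤ 1 / 2 := by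
  obtain ⟨v, rfl⟩ := QuotientAddGroup.mk_surjective x
  refine ⟨v - round v, ?_, (UnitAddCircle.norm_eq).symm, abs_sub_round v⟩
  have h : ((round v : ℝ) : UnitAddCircle) = 0 :=
    (AddCircle.coe_eq_zero_iff 1).2 ⟨round v, by simp⟩
  change (v : UnitAddCircle) = _
  rw [AddCircle.coe_sub, h, sub_zero]

lemma norm_fourier_apply (t : ℤ) (x : UnitAddCircle) : ‖fourier t x‖ = 1 := by
  rw [fourier_apply]; exact Circle.norm_coe _

lemma fourier_apply_add (t : ℤ) (x y : UnitAddCircle) :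
    fourier t (x + y) = fourier t x * fourier t y := by
  simp only [fourier_apply, smul_add, AddCircle.toCircle_add, Circle.coe_mul]

lemma fourier_apply_neg (t : ℤ) (x : UnitAddCircle) :
    fourier t (-x) = fourier (-t) x := by
  simp only [fourier_apply, smul_neg, neg_smul]

lemma norm_fourier_coe_sub_one (t : ℤ) (u : ℝ) :
    ‖fourier t (u : UnitAddCircle) - 1‖ = 2 * |Real.sin (Real.pi * t * u)| := by
  have h := Complex.norm_exp_I_mul_ofReal_sub_one (2 * Real.pi * t * u)
  rw [fourier_coe_apply]
  have e : 2 * (Real.pi : ℂ) * Complex.I * t * u / (1 : ℝ)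
      = Complex.I * ((2 * Real.pi * t * u : ℝ) : ℂ) := by
    push_cast; ring
  rw [e, h, norm_mul, Real.norm_eq_abs, Real.norm_eq_abs]
  norm_num
  congr 2; ring

lemma norm_fourier_sub_one_le (t : ℤ) (x : UnitAddCircle) :
    ‖fourier t x - 1‖ ≤ 2 * Real.pi * |(t : ℝ)| * ‖x‖ := by
  obtain ⟨u, rfl, hu, -⟩ := exists_real_representative x
  rw [norm_fourier_coe_sub_one, ← hu]
  have := Real.abs_sin_le_abs (x := Real.pi * t * u)
  rw [abs_mul, abs_mul, abs_of_pos Real.pi_pos] at this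
  linarith

/-- Jordan's inequality for the sine. It replaces the weight ‖x‖ by multiplication with e^{2πix} -
1, which acts on Fourier coefficients as a difference operator. -/
lemma four_mul_norm_le_norm_fourier_one_sub_one (x : UnitAddCircle) :
    4 * ‖x‖ ≤ ‖fourier 1 x - 1‖ := by
  obtain ⟨u, rfl, hu, hu2⟩ := exists_real_representative x
  rw [norm_fourier_coe_sub_one, ← hu]
  have h0 := abs_nonneg u
  have hpi := Real.pi_pos
  have h := Real.mul_le_sin (x := Real.pi * |u|) (by positivity) (by nlinarith)
  have e : |Real.sin (Real.pi * ((1 : ℤ) : ℝ) * u)| = Real.sin (Real.pi * |u|) := by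
    rw [Int.cast_one, mul_one, Real.abs_sin_eq_sqrt_one_sub_cos_sq]
    have : Real.cos (Real.pi * u) = Real.cos (Real.pi * |u|) := by
      rw [← Real.cos_abs (Real.pi * u), abs_mul, abs_of_pos hpi]
    rw [this, ← Real.abs_sin_eq_sqrt_one_sub_cos_sq, abs_of_nonneg]
    exact Real.sin_nonneg_of_nonneg_of_le_pi (by positivity) (by nlinarith)
  rw [e]
  have : 2 / Real.pi * (Real.pi * |u|) = 2 * |u| := by field_simp
  linarith

/-! ### Trigonometric polynomials and finite multipliers: Parseval, Bessel, convolution. -/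

/-- The trigonometric polynomial with coefficients `a t`, `t ∈ S`. -/
noncomputable def trigPoly (S : Finset ℤ) (a : ℤ → ℂ) (x : UnitAddCircle) : ℂ :=
  ∑ t ∈ S, a t * fourier t x

/-- The operator multiplying the Fourier coefficients by `a` on `S` and by `0` off `S`. -/
noncomputable def fourierMultiplier (S : Finset ℤ) (a : ℤ → ℂ) (f : UnitAddCircle → ℂ) :
    UnitAddCircle → ℂ :=
  trigPoly S fun t => a t * fourierCoeff f t

lemma continuous_trigPoly (S : Finset ℤ) (a : ℤ → ℂ) : Continuous (trigPoly S a) := by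
  unfold trigPoly; fun_prop

lemma Continuous.integrable_unitAddCircle {E : Type*} [NormedAddCommGroup E]
    {f : UnitAddCircle → E} (hf : Continuous f) : Integrable f volume :=
  hf.integrable_of_hasCompactSupport (HasCompactSupport.of_compactSpace f)

lemma trigPoly_congr_support {S S' : Finset ℤ} {a : ℤ → ℂ} (hS : ∀ t ∉ S, a t = 0)
    (hS' : ∀ t ∉ S', a t = 0) : trigPoly S a = trigPoly S' a := by
  classical
  funext x
  have key : ∀ R : Finset ℤ, R ⊆ S ∪ S' → (∀ t ∉ R, a t = 0) →
      trigPoly R a x = trigPoly (S ∪ S') a x := by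
    intro R hR h0
    exact Finset.sum_subset hR fun t _ ht => by rw [h0 t ht, zero_mul]
  rw [key S Finset.subset_union_left hS, key S' Finset.subset_union_right hS']

lemma fourierCoeff_eq_integral (f : UnitAddCircle → ℂ) (t : ℤ) :
    fourierCoeff f t = ∫ y, fourier (-t) y * f y := by
  rw [fourierCoeff, haarAddCircle_eq_volume]; rfl

lemma Integrable.mul_continuous_unitAddCircle {f g : UnitAddCircle → ℂ}
    (hf : Integrable f volume) (hg : Continuous g) : Integrable (fun x => g x * f x) volume := by
  obtain ⟨C, hC⟩ := (isCompact_univ (X := UnitAddCircle)).exists_bound_of_continuousOn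
    hg.continuousOn
  exact hf.bdd_mul hg.aestronglyMeasurable (c := C) (ae_of_all _ fun x => hC x trivial)

lemma fourierCoeff_trigPoly (S : Finset ℤ) (a : ℤ → ℂ) (n : ℤ) :
    fourierCoeff (trigPoly S a) n = if n ∈ S then a n else 0 := by
  classical
  have e : trigPoly S a = ∑ t ∈ S, fun x => a t * fourier t x := by
    funext x; simp [trigPoly]
  rw [e, fourierCoeff.sum]
  · simp only [Finset.sum_apply, fourierCoeff.const_mul, fourierCoeff_fourier]
    simp [Pi.single_apply]
  · intro t _
    rw [haarAddCircle_eq_volume]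
    exact Continuous.integrable_unitAddCircle (by fun_prop)

lemma integral_conj_trigPoly_mul (S : Finset ℤ) (a : ℤ → ℂ) {f : UnitAddCircle → ℂ}
    (hf : Integrable f volume) :
    ∫ x, conj (trigPoly S a x) * f x = ∑ t ∈ S, conj (a t) * fourierCoeff f t := by
  have e : ∀ x, conj (trigPoly S a x) * f x
      = ∑ t ∈ S, conj (a t) * (fourier (-t) x * f x) := by
    intro x
    simp only [trigPoly, map_sum, map_mul, Finset.sum_mul, fourier_neg, mul_assoc]
  simp_rw [e]
  rw [integral_finsetSum]
  · refine Finset.sum_congr rfl fun t _ => ?_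
    rw [integral_const_mul, fourierCoeff_eq_integral]
  · intro t _
    exact (Integrable.mul_continuous_unitAddCircle hf (by fun_prop)).const_mul _

lemma integral_norm_sq_trigPoly (S : Finset ℤ) (a : ℤ → ℂ) :
    ∫ x, ‖trigPoly S a x‖ ^ 2 = ∑ t ∈ S, ‖a t‖ ^ 2 := by
  have h := integral_conj_trigPoly_mul S a (continuous_trigPoly S a).integrable_unitAddCircle
  simp only [Complex.conj_mul', fourierCoeff_trigPoly] at h
  have h2 : (∫ x, ((‖trigPoly S a x‖ ^ 2 : ℝ) : ℂ)) = ((∑ t ∈ S, ‖a t‖ ^ 2 : ℝ) : ℂ) := by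
    push_cast
    rw [h]
    exact Finset.sum_congr rfl fun t ht => by rw [if_pos ht, Complex.conj_mul']
  rw [integral_complex_ofReal] at h2
  exact_mod_cast h2

lemma sum_norm_sq_fourierCoeff_le (S : Finset ℤ) {f : UnitAddCircle → ℂ}
    (hf : MemLp f 2 volume) : ∑ t ∈ S, ‖fourierCoeff f t‖ ^ 2 ≤ ∫ x, ‖f x‖ ^ 2 := by
  rw [← haarAddCircle_eq_volume] at hf ⊢
  have h := hasSum_sq_fourierCoeff (hf.toLp f)
  have e1 : ∀ i, fourierCoeff (hf.toLp f) i = fourierCoeff f i := fun i =>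
    congrFun (fourierCoeff_congr_ae hf.coeFn_toLp) i
  have e2 : ∫ x, ‖(hf.toLp f) x‖ ^ 2 ∂AddCircle.haarAddCircle
      = ∫ x, ‖f x‖ ^ 2 ∂AddCircle.haarAddCircle := by
    refine integral_congr_ae ?_
    filter_upwards [hf.coeFn_toLp] with x hx
    rw [hx]
  simp only [e1, e2] at h
  exact sum_le_hasSum S (fun i _ => by positivity) h

lemma continuous_fourierMultiplier (S : Finset ℤ) (a : ℤ → ℂ) (f : UnitAddCircle → ℂ) :
    Continuous (fourierMultiplier S a f) := continuous_trigPoly _ _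

lemma integral_norm_sq_fourierMultiplier_le {S : Finset ℤ} {a : ℤ → ℂ} {A : ℝ}
    (ha : ∀ t, ‖a t‖ ≤ A) {f : UnitAddCircle → ℂ} (hf : MemLp f 2 volume) :
    ∫ x, ‖fourierMultiplier S a f x‖ ^ 2 ≤ A ^ 2 * ∫ x, ‖f x‖ ^ 2 := by
  rw [fourierMultiplier, integral_norm_sq_trigPoly]
  calc ∑ t ∈ S, ‖a t * fourierCoeff f t‖ ^ 2
      ≤ ∑ t ∈ S, A ^ 2 * ‖fourierCoeff f t‖ ^ 2 := by
        refine Finset.sum_le_sum fun t _ => ?_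
        rw [norm_mul, mul_pow]
        gcongr
        exact ha t
    _ ≤ _ := by
        rw [← Finset.mul_sum]
        gcongr
        exact sum_norm_sq_fourierCoeff_le S hf

lemma fourierMultiplier_add (S : Finset ℤ) (a : ℤ → ℂ) {f g : UnitAddCircle → ℂ}
    (hf : Integrable f volume) (hg : Integrable g volume) (x : UnitAddCircle) :
    fourierMultiplier S a (f + g) x = fourierMultiplier S a f x + fourierMultiplier S a g x := by
  rw [← haarAddCircle_eq_volume] at hf hg
  simp only [fourierMultiplier, trigPoly, fourierCoeff.add hf hg, Pi.add_apply]
  rw [← Finset.sum_add_distrib]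
  exact Finset.sum_congr rfl fun t _ => by ring

lemma fourierMultiplier_eq_convolution (S : Finset ℤ) (a : ℤ → ℂ) {f : UnitAddCircle → ℂ}
    (hf : Integrable f volume) (x : UnitAddCircle) :
    fourierMultiplier S a f x = ∫ y, trigPoly S a (x - y) * f y := by
  have e : ∀ y, trigPoly S a (x - y) * f y
      = ∑ t ∈ S, (a t * fourier t x) * (fourier (-t) y * f y) := by
    intro y
    simp only [trigPoly, Finset.sum_mul, sub_eq_add_neg, fourier_apply_add, fourier_apply_neg]
    exact Finset.sum_congr rfl fun t _ => by ring
  simp_rw [e]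
  rw [integral_finsetSum]
  · simp only [fourierMultiplier, trigPoly]
    refine Finset.sum_congr rfl fun t _ => ?_
    rw [integral_const_mul, fourierCoeff_eq_integral]; ring
  · intro t _
    exact (Integrable.mul_continuous_unitAddCircle hf (by fun_prop)).const_mul _

/-! ### Kernel estimates at a single frequency scale. -/

lemma measurableSet_le_norm_unitAddCircle (r : ℝ) :
    MeasurableSet {x : UnitAddCircle | r ≤ ‖x‖} :=
  measurableSet_le measurable_const measurable_norm

lemma integrableOn_inv_norm_sq_unitAddCircle {r : ℝ} (hr : 0 < r) :
    IntegrableOn (fun x : UnitAddCircle => (‖x‖ ^ 2)⁻¹) {x | r ≤ ‖x‖} volume := by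
  refine Measure.integrableOn_of_bounded (M := (r ^ 2)⁻¹) (measure_ne_top _ _)
    (by fun_prop) ?_
  refine (ae_restrict_iff' (measurableSet_le_norm_unitAddCircle r)).2 (ae_of_all _ fun x hx => ?_)
  have hx : r ≤ ‖x‖ := hx
  rw [Real.norm_eq_abs, abs_of_nonneg (by positivity)]
  gcongr

/-- For |u| ≥ r one has u⁻² ≤ 2/(r² + u²), whose integral over the line is 2π/r. -/
lemma setIntegral_inv_norm_sq_le {r : ℝ} (hr : 0 < r) :
    ∫ x in {x : UnitAddCircle | r ≤ ‖x‖}, (‖x‖ ^ 2)⁻¹ ≤ 7 / r := by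
  set g : ℝ → ℝ := fun u => 2 * (r ^ 2)⁻¹ * (1 + (u / r) ^ 2)⁻¹ with hg
  have hgi : Integrable g volume :=
    (integrable_inv_one_add_sq.comp_div hr.ne').const_mul _
  have hgv : ∫ u, g u = 2 * Real.pi / r := by
    simp only [hg]
    rw [integral_const_mul, Measure.integral_comp_div (fun u : ℝ => (1 + u ^ 2)⁻¹) r,
      integral_univ_inv_one_add_sq, abs_of_pos hr, smul_eq_mul]
    field_simp
  rw [← integral_indicator (measurableSet_le_norm_unitAddCircle r),
    ← UnitAddCircle.integral_preimage (-(1 / 2))]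
  calc ∫ u : ℝ in Set.Ioc (-(1 / 2)) (-(1 / 2) + 1),
        {x : UnitAddCircle | r ≤ ‖x‖}.indicator (fun x => (‖x‖ ^ 2)⁻¹) (u : UnitAddCircle)
      ≤ ∫ u : ℝ in Set.Ioc (-(1 / 2)) (-(1 / 2) + 1), g u := by
        refine integral_mono_of_nonneg (ae_of_all _ fun u => ?_) hgi.integrableOn ?_
        · exact Set.indicator_nonneg (fun x _ => by positivity) _
        · refine (ae_restrict_iff' measurableSet_Ioc).2 (ae_of_all _ fun u hu => ?_)
          have hu' : ‖(u : UnitAddCircle)‖ = |u| := by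
            refine (AddCircle.norm_coe_eq_abs_iff 1 one_ne_zero).2 ?_
            rw [abs_le, abs_one]; constructor <;> linarith [hu.1, hu.2]
          beta_reduce
          by_cases h : r ≤ |u|
          · rw [Set.indicator_of_mem (by simpa [hu'] using h), hu', sq_abs]
            have hu0 : 0 < u ^ 2 := by rw [← sq_abs]; exact pow_pos (hr.trans_le h) 2
            have h2 : r ^ 2 ≤ u ^ 2 := by rw [← sq_abs u]; gcongr
            have : g u = 2 / (r ^ 2 + u ^ 2) := by simp only [hg]; field_simp
            rw [this, inv_eq_one_div, div_le_div_iff₀ hu0 (by positivity)]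
            linarith
          · rw [Set.indicator_of_notMem (by rw [← hu'] at h; exact h)]
            positivity
    _ ≤ ∫ u, g u := setIntegral_le_integral hgi (ae_of_all _ fun u => by positivity)
    _ ≤ 7 / r := by
        rw [hgv]; gcongr; linarith [Real.pi_lt_d2]

/-- Coefficients of a bump at frequency scale `M`. -/
structure IsFrequencyBump (M : ℕ) (A : ℝ) (a : ℤ → ℂ) : Prop where
  eq_zero : ∀ t : ℤ, 2 * (M : ℤ) < |t| → a t = 0
  bound : ∀ t, ‖a t‖ ≤ A
  diff_bound : ∀ t, ‖a (t + 1) - a t‖ ≤ A / M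

namespace IsFrequencyBump

variable {M : ℕ} {A : ℝ} {a : ℤ → ℂ}

/-- The range of frequencies of a bump at scale `M`. -/
noncomputable def freqs (M : ℕ) : Finset ℤ := Finset.Icc (-(2 * (M : ℤ))) (2 * M)

lemma eq_zero_of_notMem (ha : IsFrequencyBump M A a) : ∀ t ∉ freqs M, a t = 0 := by
  intro t ht
  refine ha.eq_zero t ?_
  by_contra! h
  rw [abs_le] at h
  exact ht (Finset.mem_Icc.2 h)

lemma integral_norm_sq_le (ha : IsFrequencyBump M A a) (hM : 1 ≤ M) :
    ∫ x, ‖trigPoly (freqs M) a x‖ ^ 2 ≤ 5 * M * A ^ 2 := by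
  rw [integral_norm_sq_trigPoly]
  have hM' : (1 : ℝ) ≤ M := by exact_mod_cast hM
  calc ∑ t ∈ freqs M, ‖a t‖ ^ 2 ≤ ∑ t ∈ freqs M, A ^ 2 :=
        Finset.sum_le_sum fun t _ => by gcongr; exact ha.bound t
    _ = (4 * M + 1) * A ^ 2 := by
        rw [Finset.sum_const, nsmul_eq_mul, freqs, Int.card_Icc]
        congr 1
        have : (2 * (M : ℤ) + 1 - -(2 * M)).toNat = 4 * M + 1 := by omega
        rw [this]; push_cast; ring
    _ ≤ _ := by gcongr; linarith

/-- Summation by parts. The frequency range grows by one on the right because the shifted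
coefficients reach 2M + 1. -/
lemma fourier_one_sub_one_mul (ha : IsFrequencyBump M A a) (x : UnitAddCircle) :
    (fourier 1 x - 1) * trigPoly (freqs M) a x
      = trigPoly (Finset.Icc (-(2 * (M : ℤ))) (2 * M + 1)) (fun t => a (t - 1) - a t) x := by
  have h1 : trigPoly (Finset.Icc (-(2 * (M : ℤ))) (2 * M + 1)) a x = trigPoly (freqs M) a x := by
    refine congrFun (trigPoly_congr_support (fun t ht => ha.eq_zero_of_notMem t fun h => ht ?_)
      ha.eq_zero_of_notMem) x
    simp only [freqs, Finset.mem_Icc] at h ⊢; omega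
  have h2 : trigPoly (Finset.Icc (-(2 * (M : ℤ))) (2 * M + 1)) (fun t => a (t - 1)) x
      = fourier 1 x * trigPoly (freqs M) a x := by
    have h3 : trigPoly (Finset.Icc (-(2 * (M : ℤ))) (2 * M + 1)) (fun t => a (t - 1))
        = trigPoly (Finset.Icc (-(2 * (M : ℤ)) + 1) (2 * M + 1)) (fun t => a (t - 1)) := by
      refine trigPoly_congr_support (fun t ht => ha.eq_zero_of_notMem _ fun h => ht ?_)
        (fun t ht => ha.eq_zero_of_notMem _ fun h => ht ?_) <;>
      · simp only [freqs, Finset.mem_Icc] at h ⊢; omega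
    rw [h3, trigPoly, trigPoly, freqs, ← Finset.image_add_right_Icc,
      Finset.sum_image (fun _ _ _ _ h => by simpa using h), Finset.mul_sum]
    refine Finset.sum_congr rfl fun t _ => ?_
    rw [add_sub_cancel_right, fourier_add]; ring
  rw [sub_mul, one_mul, ← h2, ← h1]
  simp only [trigPoly, ← Finset.sum_sub_distrib, sub_mul]

/-- Parseval for the differenced coefficients: about 4M of them, each at most A/M. The 16 comes from
squaring the 4 in `four_mul_norm_le_norm_fourier_one_sub_one`. -/
lemma integral_norm_sq_mul_le (ha : IsFrequencyBump M A a) (hM : 1 ≤ M) :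
    ∫ x, (‖x‖ * ‖trigPoly (freqs M) a x‖) ^ 2 ≤ 6 * A ^ 2 / (16 * M) := by
  have hM' : (1 : ℝ) ≤ M := by exact_mod_cast hM
  have h1 : ∫ x, ‖(fourier 1 x - 1) * trigPoly (freqs M) a x‖ ^ 2 ≤ 6 * A ^ 2 / M := by
    simp_rw [ha.fourier_one_sub_one_mul]
    rw [integral_norm_sq_trigPoly]
    calc ∑ t ∈ Finset.Icc (-(2 * (M : ℤ))) (2 * M + 1), ‖a (t - 1) - a t‖ ^ 2
        ≤ ∑ t ∈ Finset.Icc (-(2 * (M : ℤ))) (2 * M + 1), (A / M) ^ 2 := by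
          refine Finset.sum_le_sum fun t _ => ?_
          have := ha.diff_bound (t - 1)
          rw [sub_add_cancel, norm_sub_rev] at this
          gcongr
      _ = (4 * M + 2) * (A / M) ^ 2 := by
          rw [Finset.sum_const, nsmul_eq_mul, Int.card_Icc]
          congr 1
          have : (2 * (M : ℤ) + 1 + 1 - -(2 * M)).toNat = 4 * M + 2 := by omega
          rw [this]; push_cast; ring
      _ ≤ (6 * M) * (A / M) ^ 2 := by gcongr; linarith
      _ = _ := by field_simp
  have hc := continuous_trigPoly (freqs M) a
  calc ∫ x, (‖x‖ * ‖trigPoly (freqs M) a x‖) ^ 2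
      ≤ ∫ x, (1 / 16) * ‖(fourier 1 x - 1) * trigPoly (freqs M) a x‖ ^ 2 := by
        refine integral_mono (Continuous.integrable_unitAddCircle (by fun_prop))
          (Continuous.integrable_unitAddCircle (by fun_prop)) fun x => ?_
        have := four_mul_norm_le_norm_fourier_one_sub_one x
        simp only [norm_mul, mul_pow]
        have h2 : (4 * ‖x‖) ^ 2 ≤ ‖fourier 1 x - 1‖ ^ 2 := by gcongr
        have h3 : 0 ≤ ‖trigPoly (freqs M) a x‖ ^ 2 := by positivity
        nlinarith
    _ ≤ (1 / 16) * (6 * A ^ 2 / M) := by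
        rw [integral_const_mul]; gcongr
    _ = _ := by field_simp

/-- Cauchy–Schwarz, splitting k as ‖x‖⁻¹ · ‖x‖k: the first factor is square integrable off the ball
of radius r, the second by `integral_norm_sq_mul_le`. -/
lemma setIntegral_norm_le (ha : IsFrequencyBump M A a) (hM : 1 ≤ M) (hA : 0 < A) {r : ℝ}
    (hr : 0 < r) :
    ∫ x in {x : UnitAddCircle | r ≤ ‖x‖}, ‖trigPoly (freqs M) a x‖ ≤ 4 * A / √(M * r) := by
  have hM' : (1 : ℝ) ≤ M := by exact_mod_cast hM
  have hc := continuous_trigPoly (freqs M) a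
  set s := √(M * r) with hs
  have hs0 : 0 < s := Real.sqrt_pos.2 (by positivity)
  have hs2 : s ^ 2 = M * r := Real.sq_sqrt (by positivity)
  -- The weight in the AM–GM form of Cauchy–Schwarz: it balances ε/r against A²/(εM), making both
  -- equal to A/s.
  set ε := A * r / s with hε
  have hε0 : 0 < ε := by positivity
  have hint : Integrable (fun x : UnitAddCircle => (‖x‖ * ‖trigPoly (freqs M) a x‖) ^ 2) volume :=
    Continuous.integrable_unitAddCircle (by fun_prop)
  calc ∫ x in {x : UnitAddCircle | r ≤ ‖x‖}, ‖trigPoly (freqs M) a x‖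
      ≤ ∫ x in {x : UnitAddCircle | r ≤ ‖x‖}, ((ε / 2) * (‖x‖ ^ 2)⁻¹
          + (1 / (2 * ε)) * (‖x‖ * ‖trigPoly (freqs M) a x‖) ^ 2) := by
        refine setIntegral_mono_on (Continuous.integrable_unitAddCircle (by fun_prop)).integrableOn
          (((integrableOn_inv_norm_sq_unitAddCircle hr).const_mul _).add
            (hint.integrableOn.const_mul _)) (measurableSet_le_norm_unitAddCircle r) fun x hx => ?_
        have hx0 : 0 < ‖x‖ := hr.trans_le hx
        set k := ‖trigPoly (freqs M) a x‖
        have : 0 ≤ (1 / (2 * ε)) * (ε * ‖x‖⁻¹ - ‖x‖ * k) ^ 2 := by positivity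
        have e : (1 / (2 * ε)) * (ε * ‖x‖⁻¹ - ‖x‖ * k) ^ 2
            = (ε / 2) * (‖x‖ ^ 2)⁻¹ + (1 / (2 * ε)) * (‖x‖ * k) ^ 2 - k := by
          field_simp; ring
        linarith
    _ = (ε / 2) * (∫ x in {x : UnitAddCircle | r ≤ ‖x‖}, (‖x‖ ^ 2)⁻¹)
          + (1 / (2 * ε)) * ∫ x in {x : UnitAddCircle | r ≤ ‖x‖},
              (‖x‖ * ‖trigPoly (freqs M) a x‖) ^ 2 := by
        rw [integral_add ((integrableOn_inv_norm_sq_unitAddCircle hr).const_mul _)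
          (hint.integrableOn.const_mul _), integral_const_mul, integral_const_mul]
    _ ≤ (ε / 2) * (7 / r) + (1 / (2 * ε)) * (6 * A ^ 2 / (16 * M)) := by
        gcongr
        · exact setIntegral_inv_norm_sq_le hr
        · exact (setIntegral_le_integral hint (ae_of_all _ fun x => by positivity)).trans
            (ha.integral_norm_sq_mul_le hM)
    _ = (7 / 2) * (A / s) + (3 / 16) * (A * s / (M * r)) := by
        rw [hε]; field_simp; ring
    _ = (7 / 2 + 3 / 16) * (A / s) := by rw [← hs2]; field_simp
    _ ≤ 4 * A / s := by
        rw [mul_div_assoc]; gcongr; norm_num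

/-- Split at the natural radius 1/M. Outside, the tail bound is 4A. Inside, the set has measure at
most 2/M, and AM–GM with weight AM (the natural height of the kernel) combines this with Parseval.
-/
lemma integral_norm_le (ha : IsFrequencyBump M A a) (hM : 1 ≤ M) (hA : 0 < A) :
    ∫ x, ‖trigPoly (freqs M) a x‖ ≤ 8 * A := by
  have hM' : (1 : ℝ) ≤ M := by exact_mod_cast hM
  have hM0 : (0 : ℝ) < M := by linarith
  have hc := continuous_trigPoly (freqs M) a
  have hr : (0 : ℝ) < 1 / M := by positivity
  have hi : Integrable (fun x => ‖trigPoly (freqs M) a x‖) volume :=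
    Continuous.integrable_unitAddCircle (by fun_prop)
  have hint : Integrable (fun x => ‖trigPoly (freqs M) a x‖ ^ 2) volume :=
    Continuous.integrable_unitAddCircle (by fun_prop)
  rw [← integral_add_compl (measurableSet_le_norm_unitAddCircle (1 / M)) hi]
  have h1 := ha.setIntegral_norm_le hM hA hr
  rw [mul_one_div_cancel hM0.ne', Real.sqrt_one, div_one] at h1
  set B := {x : UnitAddCircle | 1 / (M : ℝ) ≤ ‖x‖}ᶜ with hB
  have hBm : MeasurableSet B := (measurableSet_le_norm_unitAddCircle _).compl
  have hBv : volume.real B ≤ 2 / M := by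
    have hsub : B ⊆ Metric.closedBall 0 (1 / M) := by
      intro x hx
      simp only [hB, Set.mem_compl_iff, Set.mem_ofPred_eq, not_le] at hx
      simpa using hx.le
    calc volume.real B ≤ volume.real (Metric.closedBall (0 : UnitAddCircle) (1 / M)) :=
          measureReal_mono hsub
      _ = min 1 (2 * (1 / (M : ℝ))) := by
          rw [Measure.real, AddCircle.volume_closedBall, ENNReal.toReal_ofReal (by positivity)]
      _ ≤ 2 / (M : ℝ) := (min_le_right _ _).trans_eq (by rw [mul_one_div])
  have h2 : ∫ x in B, ‖trigPoly (freqs M) a x‖ ≤ 4 * A := by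
    calc ∫ x in B, ‖trigPoly (freqs M) a x‖
        ≤ ∫ x in B, (A * M / 2 + (1 / (2 * (A * M))) * ‖trigPoly (freqs M) a x‖ ^ 2) := by
          refine integral_mono hi.integrableOn
            ((integrable_const _).add (hint.integrableOn.const_mul _)) fun x => ?_
          set k := ‖trigPoly (freqs M) a x‖
          have h : 0 ≤ (1 / (2 * (A * M))) * (A * M - k) ^ 2 := by positivity
          have e : (1 / (2 * (A * M))) * (A * M - k) ^ 2
            = A * M / 2 + (1 / (2 * (A * M))) * k ^ 2 - k := by field_simp; ring
          have : k ≤ A * M / 2 + (1 / (2 * (A * M))) * k ^ 2 := by linarith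
          exact this
      _ = volume.real B * (A * M / 2)
          + (1 / (2 * (A * M))) * ∫ x in B, ‖trigPoly (freqs M) a x‖ ^ 2 := by
          rw [integral_add (integrable_const _) (hint.integrableOn.const_mul _),
            integral_const_mul, setIntegral_const, smul_eq_mul]
      _ ≤ (2 / M) * (A * M / 2) + (1 / (2 * (A * M))) * (5 * M * A ^ 2) := by
          gcongr
          exact (setIntegral_le_integral hint (ae_of_all _ fun x => by positivity)).trans
            (ha.integral_norm_sq_le hM)
      _ = (7 / 2) * A := by field_simp; ring
      _ ≤ 4 * A := by linarith
  linarith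

/-- Translating the kernel by y and subtracting multiplies the coefficients by e^{-2πity} - 1, which
is O(Mh) on the frequency range and has differences O(h). By the product rule the result is again a
bump at scale M, with amplitude reduced by the factor Mh. -/
lemma translate_sub (ha : IsFrequencyBump M A a) (hM : 1 ≤ M) {h : ℝ} {y : UnitAddCircle}
    (hy : ‖y‖ ≤ h) : IsFrequencyBump M (20 * A * M * h) fun t => a t * (fourier t (-y) - 1) := by
  have hA : 0 ≤ A := (norm_nonneg _).trans (ha.bound 0)
  have hM' : (1 : ℝ) ≤ M := by exact_mod_cast hM
  have hh : 0 ≤ h := (norm_nonneg y).trans hy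
  have hpi := Real.pi_lt_d2
  have hpi0 := Real.pi_pos
  have key : ∀ t : ℤ, |t| ≤ 2 * (M : ℤ) → ‖fourier t (-y) - 1‖ ≤ 13 * M * h := by
    intro t ht
    have ht' : |(t : ℝ)| ≤ 2 * M := by exact_mod_cast ht
    calc ‖fourier t (-y) - 1‖ ≤ 2 * Real.pi * |(t : ℝ)| * ‖-y‖ := norm_fourier_sub_one_le _ _
      _ ≤ 2 * 3.15 * (2 * M) * h := by rw [norm_neg]; gcongr
      _ ≤ 13 * M * h := by nlinarith [mul_nonneg (by linarith : (0 : ℝ) ≤ M) hh]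
  refine ⟨fun t ht => by rw [ha.eq_zero t ht, zero_mul], fun t => ?_, fun t => ?_⟩
  · by_cases ht : |t| ≤ 2 * (M : ℤ)
    · rw [norm_mul]
      calc ‖a t‖ * ‖fourier t (-y) - 1‖ ≤ A * (13 * M * h) := by
            gcongr
            · exact ha.bound t
            · exact key t ht
        _ ≤ _ := by nlinarith [mul_nonneg (mul_nonneg hA (by linarith : (0 : ℝ) ≤ M)) hh]
    · rw [ha.eq_zero t (by omega), zero_mul, norm_zero]; positivity
  · have e20 : 20 * A * M * h / M = 20 * (A * h) := by field_simp
    have hAh : 0 ≤ A * h := by positivity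
    have eAM : A / M * (13 * M * h) = 13 * (A * h) := by field_simp
    rw [e20]
    by_cases ht : |t| ≤ 2 * (M : ℤ)
    · have e : a (t + 1) * (fourier (t + 1) (-y) - 1) - a t * (fourier t (-y) - 1)
          = a (t + 1) * (fourier t (-y) * (fourier 1 (-y) - 1))
            + (a (t + 1) - a t) * (fourier t (-y) - 1) := by
        rw [fourier_add]; ring
      rw [e]
      refine (norm_add_le _ _).trans ?_
      rw [norm_mul, norm_mul, norm_mul, norm_fourier_apply, one_mul]
      have h1 : ‖fourier 1 (-y) - 1‖ ≤ 2 * 3.15 * h := by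
        calc ‖fourier 1 (-y) - 1‖ ≤ 2 * Real.pi * |((1 : ℤ) : ℝ)| * ‖-y‖ :=
              norm_fourier_sub_one_le _ _
          _ ≤ 2 * 3.15 * 1 * h := by rw [norm_neg]; gcongr; simp
          _ = _ := by ring
      calc ‖a (t + 1)‖ * ‖fourier 1 (-y) - 1‖ + ‖a (t + 1) - a t‖ * ‖fourier t (-y) - 1‖
          ≤ A * (2 * 3.15 * h) + A / M * (13 * M * h) := by
            gcongr
            · exact ha.bound _
            · exact ha.diff_bound t
            · exact key t ht
        _ ≤ 20 * (A * h) := by rw [eAM]; nlinarith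
    · have h0 : a t = 0 := ha.eq_zero t (by omega)
      rw [h0, zero_mul, sub_zero, norm_mul]
      by_cases ht1 : |t + 1| ≤ 2 * (M : ℤ)
      · have hd := ha.diff_bound t
        rw [h0, sub_zero] at hd
        calc ‖a (t + 1)‖ * ‖fourier (t + 1) (-y) - 1‖ ≤ A / M * (13 * M * h) := by
              gcongr
              exact key _ ht1
          _ ≤ _ := by rw [eAM]; linarith
      · rw [ha.eq_zero (t + 1) (by omega), norm_zero, zero_mul]; positivity

end IsFrequencyBump

lemma trigPoly_translate_sub (S : Finset ℤ) (a : ℤ → ℂ) (x y : UnitAddCircle) :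
    trigPoly S a (x - y) - trigPoly S a x
      = trigPoly S (fun t => a t * (fourier t (-y) - 1)) x := by
  simp only [trigPoly, ← Finset.sum_sub_distrib, sub_eq_add_neg x, fourier_apply_add]
  exact Finset.sum_congr rfl fun t _ => by ring

/-- Two regimes. For small Mh the translated difference is itself a small bump. For large Mh
cancellation is useless and both terms are bounded by the tail off radius h, which is available
since ‖x‖ ≥ 2h and ‖y‖ ≤ h force ‖x - y‖ ≥ h. -/
lemma IsFrequencyBump.integral_translate_sub_le {M : ℕ} {A : ℝ} {a : ℤ → ℂ}
    (ha : IsFrequencyBump M A a) (hM : 1 ≤ M) (hA : 0 < A) {h : ℝ} (hh : 0 < h)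
    {y : UnitAddCircle} (hy : ‖y‖ ≤ h) :
    ∫ x in {x : UnitAddCircle | 2 * h ≤ ‖x‖},
        ‖trigPoly (freqs M) a (x - y) - trigPoly (freqs M) a x‖
      ≤ 160 * A * min (M * h) (1 / √(M * h)) := by
  have hM' : (1 : ℝ) ≤ M := by exact_mod_cast hM
  have hM0 : (0 : ℝ) < M := by linarith
  have hc := continuous_trigPoly (freqs M) a
  have hi : Integrable (fun x => ‖trigPoly (freqs M) a (x - y) - trigPoly (freqs M) a x‖) volume :=
    Continuous.integrable_unitAddCircle (by fun_prop)
  rw [mul_min_of_nonneg _ _ (by positivity)]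
  refine le_min ?_ ?_
  · refine (setIntegral_le_integral hi (ae_of_all _ fun x => by positivity)).trans ?_
    simp_rw [trigPoly_translate_sub]
    exact ((ha.translate_sub hM hy).integral_norm_le hM (by positivity)).trans_eq (by ring)
  · have hs := measurableSet_le_norm_unitAddCircle (2 * h)
    have hi1 : Integrable (fun x => ‖trigPoly (freqs M) a (x - y)‖) volume :=
      Continuous.integrable_unitAddCircle (by fun_prop)
    have hi2 : Integrable (fun x => ‖trigPoly (freqs M) a x‖) volume :=
      Continuous.integrable_unitAddCircle (by fun_prop)
    have h1 : ∫ x in {x : UnitAddCircle | 2 * h ≤ ‖x‖}, ‖trigPoly (freqs M) a x‖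
        ≤ ∫ x in {x : UnitAddCircle | h ≤ ‖x‖}, ‖trigPoly (freqs M) a x‖ := by
      refine setIntegral_mono_set hi2.integrableOn (ae_of_all _ fun x => by positivity)
        (LE.le.eventuallyLE fun x hx => ?_)
      have hx : 2 * h ≤ ‖x‖ := hx
      change h ≤ ‖x‖
      linarith
    have h2 : ∫ x in {x : UnitAddCircle | 2 * h ≤ ‖x‖}, ‖trigPoly (freqs M) a (x - y)‖
        ≤ ∫ x in {x : UnitAddCircle | h ≤ ‖x‖}, ‖trigPoly (freqs M) a x‖ := by
      rw [← integral_indicator hs, ← integral_indicator (measurableSet_le_norm_unitAddCircle h),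
        ← integral_sub_right_eq_self (fun x => ({x : UnitAddCircle | h ≤ ‖x‖}.indicator
          (fun x => ‖trigPoly (freqs M) a x‖) x)) y]
      refine integral_mono (hi1.indicator hs) ((hi2.indicator
        (measurableSet_le_norm_unitAddCircle h)).comp_sub_right y) fun x => ?_
      by_cases hx : x ∈ {x : UnitAddCircle | 2 * h ≤ ‖x‖}
      · have hx' : x - y ∈ {x : UnitAddCircle | h ≤ ‖x‖} := by
          have h3 := norm_sub_norm_le x y
          have hx : 2 * h ≤ ‖x‖ := hx
          change h ≤ ‖x - y‖
          linarith
        simp only [Set.indicator_of_mem hx, Set.indicator_of_mem hx']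
        exact le_rfl
      · simp only [Set.indicator_of_notMem hx]
        exact Set.indicator_nonneg (fun x _ => norm_nonneg _) _
    have h3 := ha.setIntegral_norm_le hM hA hh
    have hs0 : 0 < √(M * h) := Real.sqrt_pos.2 (by positivity)
    calc _ ≤ ∫ x in {x : UnitAddCircle | 2 * h ≤ ‖x‖},
          (‖trigPoly (freqs M) a (x - y)‖ + ‖trigPoly (freqs M) a x‖) :=
        integral_mono hi.integrableOn (hi1.integrableOn.add hi2.integrableOn)
          fun x => norm_sub_le _ _
      _ ≤ 4 * A / √(M * h) + 4 * A / √(M * h) := by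
        rw [integral_add hi1.integrableOn hi2.integrableOn]
        linarith
      _ = 8 * A * (1 / √(M * h)) := by ring
      _ ≤ 160 * A * (1 / √(M * h)) := by gcongr; norm_num

/-! ### Dyadic decomposition and the Hörmander condition. -/

/-- The discrete Marcinkiewicz condition of first order. -/
structure IsDiscreteMarcinkiewicz (A : ℝ) (a : ℤ → ℂ) : Prop where
  bound : ∀ t, ‖a t‖ ≤ A
  diff_bound : ∀ t : ℤ, |(t : ℝ)| * ‖a (t + 1) - a t‖ ≤ A

/-- The trapezoid that is `1` for `|t| ≤ 2 ^ j` and `0` for `|t| ≥ 2 ^ (j + 1)`. -/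
noncomputable def trapezoid (j : ℕ) (t : ℤ) : ℝ := max 0 (min 1 (2 - |(t : ℝ)| / 2 ^ j))

lemma trapezoid_nonneg (j : ℕ) (t : ℤ) : 0 ≤ trapezoid j t := le_max_left _ _

lemma trapezoid_le_one (j : ℕ) (t : ℤ) : trapezoid j t ≤ 1 :=
  max_le zero_le_one (min_le_left _ _)

lemma trapezoid_eq_one {j : ℕ} {t : ℤ} (h : |(t : ℝ)| ≤ 2 ^ j) : trapezoid j t = 1 := by
  have : |(t : ℝ)| / 2 ^ j ≤ 1 := (div_le_one (by positivity)).2 h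
  rw [trapezoid, min_eq_left (by linarith), max_eq_right zero_le_one]

lemma trapezoid_eq_zero {j : ℕ} {t : ℤ} (h : 2 * 2 ^ j ≤ |(t : ℝ)|) : trapezoid j t = 0 := by
  have : 2 ≤ |(t : ℝ)| / 2 ^ j := (le_div_iff₀ (by positivity)).2 h
  exact max_eq_left ((min_le_right _ _).trans (by linarith))

lemma abs_trapezoid_add_one_sub_le (j : ℕ) (t : ℤ) :
    |trapezoid j (t + 1) - trapezoid j t| ≤ 1 / 2 ^ j := by
  have h1 : |(|((t + 1 : ℤ) : ℝ)| / 2 ^ j - |(t : ℝ)| / 2 ^ j)| ≤ 1 / 2 ^ j := by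
    rw [← sub_div, abs_div, abs_of_pos (by positivity : (0 : ℝ) < 2 ^ j)]
    gcongr
    refine (abs_abs_sub_abs_le_abs_sub _ _).trans ?_
    push_cast; simp
  unfold trapezoid
  generalize |((t + 1 : ℤ) : ℝ)| / 2 ^ j = u at *
  generalize |(t : ℝ)| / 2 ^ j = v at *
  generalize (1 : ℝ) / 2 ^ j = w at *
  rw [abs_le] at h1 ⊢
  constructor <;> rcases max_cases 0 (min 1 (2 - u)) with h | h <;>
    rcases max_cases 0 (min 1 (2 - v)) with h' | h' <;>
    rcases min_cases 1 (2 - u) with k | k <;> rcases min_cases 1 (2 - v) with k' | k' <;>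
    linarith

/-- A partition of unity into tents at the dyadic scales `2 ^ j`. -/
noncomputable def dyadicTent : ℕ → ℤ → ℝ
  | 0, t => trapezoid 0 t
  | j + 1, t => trapezoid (j + 1) t - trapezoid j t

lemma sum_dyadicTent (J : ℕ) (t : ℤ) :
    ∑ j ∈ Finset.range (J + 1), dyadicTent j t = trapezoid J t := by
  induction J with
  | zero => simp [dyadicTent]
  | succ J ih => rw [Finset.sum_range_succ, ih, dyadicTent]; ring

lemma abs_dyadicTent_le (j : ℕ) (t : ℤ) : |dyadicTent j t| ≤ 1 := by
  cases j with
  | zero =>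
    rw [dyadicTent, abs_of_nonneg (trapezoid_nonneg _ _)]
    exact trapezoid_le_one _ _
  | succ j =>
    rw [dyadicTent, abs_le]
    constructor <;> linarith [trapezoid_nonneg j t, trapezoid_le_one j t,
      trapezoid_nonneg (j + 1) t, trapezoid_le_one (j + 1) t]

lemma dyadicTent_eq_zero {j : ℕ} {t : ℤ} (h : 2 * 2 ^ j ≤ |(t : ℝ)|) : dyadicTent j t = 0 := by
  cases j with
  | zero => exact trapezoid_eq_zero h
  | succ j =>
    rw [dyadicTent, trapezoid_eq_zero h, trapezoid_eq_zero, sub_zero]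
    refine le_trans ?_ h
    gcongr <;> simp

lemma abs_dyadicTent_add_one_sub_le (j : ℕ) (t : ℤ) :
    |dyadicTent j (t + 1) - dyadicTent j t| ≤ 3 / 2 ^ j := by
  cases j with
  | zero =>
    refine (abs_trapezoid_add_one_sub_le 0 t).trans ?_
    norm_num
  | succ j =>
    have h1 := abs_trapezoid_add_one_sub_le (j + 1) t
    have h2 := abs_trapezoid_add_one_sub_le j t
    have e : (1 : ℝ) / 2 ^ j = 2 / 2 ^ (j + 1) := by rw [pow_succ]; field_simp
    have e' : (3 : ℝ) / 2 ^ (j + 1) = 1 / 2 ^ (j + 1) + 2 / 2 ^ (j + 1) := by ring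
    rw [e] at h2
    rw [e', dyadicTent, dyadicTent]
    rw [abs_le] at *
    constructor <;> linarith [h1.1, h1.2, h2.1, h2.2]

/-- For j ≥ 1 the tent vanishes when |t| ≤ 2^(j-1), so wherever it matters the weighted condition
gives differences of `a` of size at most 2A/2^j; for j = 0 the sup bound does. Adding 3A/2^j from
the slope of the tent makes 5A. -/
lemma IsDiscreteMarcinkiewicz.isFrequencyBump_mul_dyadicTent {A : ℝ} {a : ℤ → ℂ}
    (ha : IsDiscreteMarcinkiewicz A a) (j : ℕ) :
    IsFrequencyBump (2 ^ j) (5 * A) fun t => a t * dyadicTent j t := by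
  have hA : 0 ≤ A := (norm_nonneg _).trans (ha.bound 0)
  refine ⟨fun t ht => ?_, fun t => ?_, fun t => ?_⟩
  · have : (2 : ℝ) * 2 ^ j ≤ |(t : ℝ)| := by
      have := ht.le; push_cast at this; exact_mod_cast this
    rw [dyadicTent_eq_zero this]; simp
  · rw [norm_mul, Complex.norm_real, Real.norm_eq_abs]
    calc ‖a t‖ * |dyadicTent j t| ≤ A * 1 := by
          gcongr
          · exact ha.bound t
          · exact abs_dyadicTent_le j t
      _ ≤ 5 * A := by linarith
  · have e : a (t + 1) * (dyadicTent j (t + 1) : ℂ) - a t * (dyadicTent j t : ℂ)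
        = a (t + 1) * ((dyadicTent j (t + 1) - dyadicTent j t : ℝ) : ℂ)
          + (a (t + 1) - a t) * (dyadicTent j t : ℂ) := by push_cast; ring
    rw [e]
    refine (norm_add_le _ _).trans ?_
    rw [norm_mul, norm_mul, Complex.norm_real, Complex.norm_real, Real.norm_eq_abs,
      Real.norm_eq_abs]
    have h1 : ‖a (t + 1)‖ * |dyadicTent j (t + 1) - dyadicTent j t| ≤ A * (3 / 2 ^ j) := by
      gcongr
      · exact ha.bound _
      · exact abs_dyadicTent_add_one_sub_le j t
    have h2 : ‖a (t + 1) - a t‖ * |dyadicTent j t| ≤ 2 * A / 2 ^ j := by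
      by_cases h0 : dyadicTent j t = 0
      · rw [h0, abs_zero, mul_zero]; positivity
      · have h3 : ‖a (t + 1) - a t‖ ≤ 2 * A / 2 ^ j := by
          cases j with
          | zero =>
            refine (norm_sub_le _ _).trans ?_
            have := ha.bound t
            have := ha.bound (t + 1)
            norm_num; linarith
          | succ j =>
            have ht : (2 : ℝ) ^ j < |(t : ℝ)| := by
              by_contra! ht
              refine h0 ?_
              rw [dyadicTent, trapezoid_eq_one ht, trapezoid_eq_one, sub_self]
              exact ht.trans (by gcongr <;> simp)
            have h4 := ha.diff_bound t
            rw [le_div_iff₀ (by positivity), pow_succ]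
            have : (2 : ℝ) ^ j * ‖a (t + 1) - a t‖ ≤ A :=
              le_trans (by gcongr) h4
            linarith
        calc _ ≤ 2 * A / 2 ^ j * 1 := by
              gcongr
              exact abs_dyadicTent_le j t
          _ = _ := mul_one _
    have e2 : 5 * A / ((2 ^ j : ℕ) : ℝ) = A * (3 / 2 ^ j) + 2 * A / 2 ^ j := by
      push_cast; ring
    rw [e2]
    linarith

/-- The right side is the increment of the bounded function 12√u/(1+√u) as u doubles, so sums over
dyadic scales telescope without a split where u crosses 1. The 12 suffices because 12(√2 - 1)
exceeds 2.42 · 2, the bound for (1 + √2 v)(1 + v) when v = √u ≤ 1. -/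
lemma min_self_inv_sqrt_le_sub {u : ℝ} (hu : 0 < u) :
    min u (1 / √u) ≤ 12 * (√(2 * u) / (1 + √(2 * u))) - 12 * (√u / (1 + √u)) := by
  set v := √u with hv
  have hv0 : 0 < v := Real.sqrt_pos.2 hu
  have hvu : u = v ^ 2 := (Real.sq_sqrt hu.le).symm
  set c := √2 with hc
  have hc1 : 1.41 < c := by
    rw [hc]; exact Real.lt_sqrt_of_sq_lt (by norm_num)
  have hc2 : c < 1.42 := by
    rw [hc, Real.sqrt_lt' (by norm_num)]; norm_num
  have e : √(2 * u) = c * v := by rw [Real.sqrt_mul zero_le_two]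
  rw [e]
  have e2 : 12 * (c * v / (1 + c * v)) - 12 * (v / (1 + v))
      = 12 * (c - 1) * v / ((1 + c * v) * (1 + v)) := by
    have h1 : (1 + c * v) ≠ 0 := by positivity
    have h2 : (1 + v) ≠ 0 := by positivity
    field_simp; ring
  rw [e2]
  rcases le_total v 1 with h | h
  · refine (min_le_left _ _).trans ?_
    rw [hvu, le_div_iff₀ (by positivity)]
    have h1 : 1 + c * v ≤ 2.42 := by nlinarith
    have h2 : (1 + c * v) * (1 + v) ≤ 2.42 * 2 := by gcongr; linarith
    calc v ^ 2 * ((1 + c * v) * (1 + v)) ≤ v ^ 2 * (2.42 * 2) := by gcongr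
      _ ≤ 4.92 * v := by nlinarith
      _ ≤ _ := by nlinarith
  · refine (min_le_right _ _).trans ?_
    rw [div_le_div_iff₀ hv0 (by positivity)]
    have h1 : 1 + c * v ≤ 2.42 * v := by nlinarith
    have h2 : (1 + c * v) * (1 + v) ≤ (2.42 * v) * (2 * v) := by gcongr; linarith
    nlinarith [mul_pos hv0 hv0]

lemma sum_min_dyadic_le {h : ℝ} (hh : 0 < h) (J : ℕ) :
    ∑ j ∈ Finset.range J, min (2 ^ j * h) (1 / √(2 ^ j * h)) ≤ 12 := by
  set F : ℕ → ℝ := fun j => 12 * (√(2 ^ j * h) / (1 + √(2 ^ j * h))) with hF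
  calc ∑ j ∈ Finset.range J, min (2 ^ j * h) (1 / √(2 ^ j * h))
      ≤ ∑ j ∈ Finset.range J, (F (j + 1) - F j) := by
        refine Finset.sum_le_sum fun j _ => ?_
        have := min_self_inv_sqrt_le_sub (u := 2 ^ j * h) (by positivity)
        rwa [← mul_assoc, ← pow_succ'] at this
    _ = F J - F 0 := Finset.sum_range_sub F J
    _ ≤ 12 := by
        have h1 : F J ≤ 12 * 1 := by
          simp only [hF]
          gcongr
          rw [div_le_one (by positivity)]; linarith
        have h2 : 0 ≤ F 0 := by simp only [hF]; positivity
        linarith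

/-- The Hörmander condition, uniformly in the support of the coefficients. -/
lemma IsDiscreteMarcinkiewicz.integral_translate_sub_le {A : ℝ} (hA : 0 < A) {S : Finset ℤ}
    {a : ℤ → ℂ} (ha : IsDiscreteMarcinkiewicz A a) (hS : ∀ t ∉ S, a t = 0) {h : ℝ} (hh : 0 < h)
    {y : UnitAddCircle} (hy : ‖y‖ ≤ h) :
    ∫ x in {x : UnitAddCircle | 2 * h ≤ ‖x‖}, ‖trigPoly S a (x - y) - trigPoly S a x‖
      ≤ 9600 * A := by
  -- With 2^J beyond every frequency in `S`, the tents up to J sum to 1 on `S`. The final bound does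
  -- not depend on J.
  obtain ⟨J, hJ⟩ : ∃ J : ℕ, ∀ t ∈ S, |(t : ℝ)| ≤ 2 ^ J := by
    obtain ⟨B, hB⟩ := (S.finite_toSet.image fun t : ℤ => |(t : ℝ)|).bddAbove
    obtain ⟨J, hJ⟩ := pow_unbounded_of_one_lt B (one_lt_two)
    exact ⟨J, fun t ht => (hB ⟨t, ht, rfl⟩).trans hJ.le⟩
  set b : ℕ → ℤ → ℂ := fun j t => a t * dyadicTent j t with hb
  have hbump : ∀ j, IsFrequencyBump (2 ^ j) (5 * A) (b j) :=
    ha.isFrequencyBump_mul_dyadicTent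
  have hk : ∀ x, trigPoly S a x
      = ∑ j ∈ Finset.range (J + 1), trigPoly (IsFrequencyBump.freqs (2 ^ j)) (b j) x := by
    intro x
    have e : ∀ j, trigPoly (IsFrequencyBump.freqs (2 ^ j)) (b j) = trigPoly S (b j) := fun j =>
      trigPoly_congr_support (hbump j).eq_zero_of_notMem fun t ht => by simp [hb, hS t ht]
    simp only [e]
    simp only [trigPoly]
    rw [Finset.sum_comm]
    refine Finset.sum_congr rfl fun t ht => ?_
    rw [← Finset.sum_mul]
    congr 1
    simp only [hb]
    rw [← Finset.mul_sum, ← Complex.ofReal_sum, sum_dyadicTent, trapezoid_eq_one (hJ t ht)]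
    simp
  have hc : ∀ j, Continuous (trigPoly (IsFrequencyBump.freqs (2 ^ j)) (b j)) :=
    fun j => continuous_trigPoly _ _
  have hi : ∀ j, Integrable (fun x => ‖trigPoly (IsFrequencyBump.freqs (2 ^ j)) (b j) (x - y)
      - trigPoly (IsFrequencyBump.freqs (2 ^ j)) (b j) x‖) volume := fun j =>
    Continuous.integrable_unitAddCircle (by have := hc j; fun_prop)
  have hcS := continuous_trigPoly S a
  have hiS : Integrable (fun x => ‖trigPoly S a (x - y) - trigPoly S a x‖) volume :=
    Continuous.integrable_unitAddCircle (by fun_prop)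
  calc _ ≤ ∫ x in {x : UnitAddCircle | 2 * h ≤ ‖x‖}, ∑ j ∈ Finset.range (J + 1),
        ‖trigPoly (IsFrequencyBump.freqs (2 ^ j)) (b j) (x - y)
          - trigPoly (IsFrequencyBump.freqs (2 ^ j)) (b j) x‖ := by
        refine integral_mono hiS.integrableOn
          (integrable_finsetSum _ fun j _ => (hi j).integrableOn) fun x => ?_
        simp only [hk]
        rw [← Finset.sum_sub_distrib]
        exact norm_sum_le _ _
    _ = ∑ j ∈ Finset.range (J + 1), ∫ x in {x : UnitAddCircle | 2 * h ≤ ‖x‖},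
        ‖trigPoly (IsFrequencyBump.freqs (2 ^ j)) (b j) (x - y)
          - trigPoly (IsFrequencyBump.freqs (2 ^ j)) (b j) x‖ :=
        integral_finsetSum _ fun j _ => (hi j).integrableOn
    _ ≤ ∑ j ∈ Finset.range (J + 1), 160 * (5 * A) * min (2 ^ j * h) (1 / √(2 ^ j * h)) := by
        refine Finset.sum_le_sum fun j _ => ?_
        have := (hbump j).integral_translate_sub_le Nat.one_le_two_pow (by positivity) hh hy
        push_cast at this
        exact this
    _ ≤ 160 * (5 * A) * 12 := by
        rw [← Finset.mul_sum]
        gcongr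
        exact sum_min_dyadic_le hh _
    _ = 9600 * A := by ring

/-! ### Arcs and the Calderón–Zygmund stopping construction. -/

/-- The representative in `(0, 1]` of a point of the circle. -/
noncomputable def unitRepr (x : UnitAddCircle) : ℝ := (AddCircle.equivIoc 1 0 x : ℝ)

lemma measurable_unitRepr : Measurable unitRepr :=
  measurable_subtype_coe.comp (AddCircle.measurableEquivIoc 1 0).measurable

lemma coe_unitRepr (x : UnitAddCircle) : (unitRepr x : UnitAddCircle) = x :=
  (AddCircle.equivIoc 1 0).symm_apply_apply x

lemma unitRepr_mem (x : UnitAddCircle) : unitRepr x ∈ Set.Ioc (0 : ℝ) 1 := by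
  obtain ⟨h1, h2⟩ := (AddCircle.equivIoc 1 0 x).2
  exact ⟨h1, h2.trans_eq (zero_add 1)⟩

lemma unitRepr_coe {u : ℝ} (hu : u ∈ Set.Ioc (0 : ℝ) 1) : unitRepr (u : UnitAddCircle) = u := by
  have h : (⟨u, by rwa [zero_add]⟩ : Set.Ioc (0 : ℝ) (0 + 1))
      = AddCircle.equivIoc 1 0 (u : UnitAddCircle) :=
    ((AddCircle.equivIoc 1 0).apply_symm_apply _).symm
  exact (congrArg Subtype.val h).symm

/-- The arc of the circle with left end point `a` and length `h`. -/
def arc (a h : ℝ) : Set UnitAddCircle := {x | unitRepr x ∈ Set.Ioc a (a + h)}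

lemma mem_arc {a h : ℝ} {x : UnitAddCircle} :
    x ∈ arc a h ↔ a < unitRepr x ∧ unitRepr x ≤ a + h := Iff.rfl

lemma measurableSet_arc (a h : ℝ) : MeasurableSet (arc a h) :=
  measurable_unitRepr measurableSet_Ioc

lemma arc_zero_one : arc 0 1 = Set.univ :=
  Set.eq_univ_of_forall fun x => by simpa [mem_arc] using unitRepr_mem x

lemma volume_real_arc {a h : ℝ} (ha : 0 ≤ a) (hh : 0 ≤ h) (hah : a + h ≤ 1) :
    volume.real (arc a h) = h := by
  rw [Measure.real, AddCircle.add_projection_respects_measure 1 0 (measurableSet_arc a h)]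
  have : (QuotientAddGroup.mk ⁻¹' arc a h ∩ Set.Ioc (0 : ℝ) (0 + 1) : Set ℝ)
      = Set.Ioc a (a + h) := by
    ext u
    rw [zero_add]
    constructor
    · rintro ⟨h1, h2⟩
      have h1 : unitRepr (u : UnitAddCircle) ∈ Set.Ioc a (a + h) := h1
      rwa [unitRepr_coe h2] at h1
    · intro h1
      have h2 : u ∈ Set.Ioc (0 : ℝ) 1 := ⟨ha.trans_lt h1.1, h1.2.trans hah⟩
      refine ⟨?_, h2⟩
      change unitRepr (u : UnitAddCircle) ∈ Set.Ioc a (a + h)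
      rwa [unitRepr_coe h2]
  rw [this, Real.volume_Ioc, add_sub_cancel_left, ENNReal.toReal_ofReal hh]

lemma norm_sub_le_of_mem_arc {a h : ℝ} {x : UnitAddCircle} (hx : x ∈ arc a h) :
    ‖x - (a : UnitAddCircle)‖ ≤ h := by
  rw [← coe_unitRepr x, ← AddCircle.coe_sub]
  refine (UnitAddCircle.norm_eq (x := unitRepr x - a)).trans_le ?_
  have h1 := round_le (unitRepr x - a) 0
  rw [Int.cast_zero, sub_zero] at h1
  refine h1.trans ?_
  rw [mem_arc] at hx
  rw [abs_of_pos (by linarith)]; linarith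

lemma arc_union_arc (a : ℝ) {h : ℝ} (hh : 0 ≤ h) :
    arc a (h / 2) ∪ arc (a + h / 2) (h / 2) = arc a h := by
  have hle : a + h / 2 ≤ a + h := by linarith [hh]
  ext x
  simp only [Set.mem_union, mem_arc]
  constructor
  · rintro (⟨h1, h2⟩ | ⟨h1, h2⟩)
    · exact ⟨h1, h2.trans hle⟩
    · exact ⟨by linarith, by linarith⟩
  · rintro ⟨h1, h2⟩
    rcases le_or_gt (unitRepr x) (a + h / 2) with h3 | h3
    · exact Or.inl ⟨h1, h3⟩
    · exact Or.inr ⟨h3, by linarith⟩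

lemma disjoint_arc_arc (a h h' : ℝ) : Disjoint (arc a h) (arc (a + h) h') :=
  Set.disjoint_left.2 fun x h1 h2 => by
    rw [mem_arc] at h1 h2; linarith [h1.2, h2.1]

/-- Calderón–Zygmund stopping by repeated bisection, stopped after `n` steps. -/
lemma exists_stopping_arcs {F : UnitAddCircle → ℝ} (hF : Integrable F volume) (hF0 : ∀ x, 0 ≤ F x)
    {s : ℝ} (n : ℕ) : ∀ {a h : ℝ}, 0 ≤ a → 0 < h → a + h ≤ 1 →
    ∫ x in arc a h, F x ≤ s * h →
    ∃ Q : Finset (ℝ × ℝ), (∀ p ∈ Q, 0 ≤ p.1 ∧ 0 < p.2 ∧ p.1 + p.2 ≤ 1) ∧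
      (Q : Set (ℝ × ℝ)).PairwiseDisjoint (fun p => arc p.1 p.2) ∧
      (⋃ p ∈ Q, arc p.1 p.2) = arc a h ∧
      ∀ p ∈ Q, ∫ x in arc p.1 p.2, F x ≤ 2 * s * p.2 ∧
        (s * p.2 < ∫ x in arc p.1 p.2, F x ∨ p.2 ≤ h / 2 ^ n) := by
  classical
  induction n with
  | zero =>
    intro a h ha hh hah hI
    have h0 : 0 ≤ s * h := le_trans (setIntegral_nonneg (measurableSet_arc a h) fun x _ => hF0 x) hI
    refine ⟨{(a, h)}, by simp [ha, hh, hah], by simp, by simp, ?_⟩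
    intro p hp
    rw [Finset.mem_singleton] at hp
    subst hp
    exact ⟨by dsimp only; linarith, Or.inr (by simp)⟩
  | succ n ih =>
    intro a h ha hh hah hI
    have half : ∀ b : ℝ, 0 ≤ b → b + h / 2 ≤ 1 → arc b (h / 2) ⊆ arc a h →
        ∃ Q : Finset (ℝ × ℝ), (∀ p ∈ Q, 0 ≤ p.1 ∧ 0 < p.2 ∧ p.1 + p.2 ≤ 1) ∧
          (Q : Set (ℝ × ℝ)).PairwiseDisjoint (fun p => arc p.1 p.2) ∧
          (⋃ p ∈ Q, arc p.1 p.2) = arc b (h / 2) ∧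
          ∀ p ∈ Q, ∫ x in arc p.1 p.2, F x ≤ 2 * s * p.2 ∧
            (s * p.2 < ∫ x in arc p.1 p.2, F x ∨ p.2 ≤ h / 2 ^ (n + 1)) := by
      intro b hb hb1 hsub
      by_cases hs : ∫ x in arc b (h / 2), F x ≤ s * (h / 2)
      · obtain ⟨Q, h1, h2, h3, h4⟩ := ih hb (half_pos hh) hb1 hs
        refine ⟨Q, h1, h2, h3, fun p hp => ⟨(h4 p hp).1, (h4 p hp).2.imp_right fun h5 => ?_⟩⟩
        rwa [pow_succ', ← div_div]
      · refine ⟨{(b, h / 2)}, by simp [hb, hh, hb1], by simp, by simp, ?_⟩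
        intro p hp
        rw [Finset.mem_singleton] at hp
        subst hp
        -- The half has average above s, so it is kept; its parent has average at most s and twice
        -- the length, so the average on the half is at most 2s.
        refine ⟨?_, Or.inl (not_le.1 hs)⟩
        calc ∫ x in arc b (h / 2), F x ≤ ∫ x in arc a h, F x :=
              setIntegral_mono_set hF.integrableOn (ae_of_all _ hF0) (LE.le.eventuallyLE hsub)
          _ ≤ _ := hI.trans_eq (by ring)
    obtain ⟨Q₁, h1, h2, h3, h4⟩ := half a ha (by linarith)
      (by rw [← arc_union_arc a hh.le]; exact Set.subset_union_left)
    obtain ⟨Q₂, k1, k2, k3, k4⟩ := half (a + h / 2) (by linarith) (by linarith)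
      (by rw [← arc_union_arc a hh.le]; exact Set.subset_union_right)
    refine ⟨Q₁ ∪ Q₂, ?_, ?_, ?_, ?_⟩
    · intro p hp
      exact (Finset.mem_union.1 hp).elim (h1 p) (k1 p)
    · rw [Finset.coe_union]
      refine h2.union k2 fun p hp q hq _ => ?_
      refine (disjoint_arc_arc a (h / 2) (h / 2)).mono ?_ ?_
      · rw [← h3]; exact Set.subset_biUnion_of_mem (u := fun p : ℝ × ℝ => arc p.1 p.2) hp
      · rw [← k3]; exact Set.subset_biUnion_of_mem (u := fun p : ℝ × ℝ => arc p.1 p.2) hq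
    · rw [Finset.set_biUnion_union, h3, k3, arc_union_arc a hh.le]
    · intro p hp
      exact (Finset.mem_union.1 hp).elim (h4 p) (k4 p)

/-! ### Action on mean-zero pieces and the weak type (1,1) inequality. -/

lemma fourierMultiplier_sum (S : Finset ℤ) (a : ℤ → ℂ) {ι : Type*} (Q : Finset ι)
    {f : ι → UnitAddCircle → ℂ} (hf : ∀ i ∈ Q, Integrable (f i) volume) (x : UnitAddCircle) :
    fourierMultiplier S a (∑ i ∈ Q, f i) x = ∑ i ∈ Q, fourierMultiplier S a (f i) x := by
  rw [← haarAddCircle_eq_volume] at hf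
  simp only [fourierMultiplier, trigPoly, fourierCoeff.sum Q f hf, Finset.sum_apply]
  rw [Finset.sum_comm]
  refine Finset.sum_congr rfl fun t _ => ?_
  rw [Finset.mul_sum, Finset.sum_mul]

section atom

variable {S : Finset ℤ} {a : ℤ → ℂ} {b : UnitAddCircle → ℂ} {c : UnitAddCircle} {h : ℝ}

lemma fourierMultiplier_eq_of_integral_eq_zero (S : Finset ℤ) (a : ℤ → ℂ)
    (hb : Integrable b volume) (hb0 : ∫ y, b y = 0) (c x : UnitAddCircle) :
    fourierMultiplier S a b x = ∫ y, (trigPoly S a (x - y) - trigPoly S a (x - c)) * b y := by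
  have hc := continuous_trigPoly S a
  have h1 : Integrable (fun y => trigPoly S a (x - y) * b y) volume :=
    Integrable.mul_continuous_unitAddCircle hb (by fun_prop)
  simp_rw [sub_mul]
  rw [fourierMultiplier_eq_convolution S a hb, integral_sub h1 (hb.const_mul _),
    integral_const_mul, hb0, mul_zero, sub_zero]

/-- The crude Lipschitz bound of the kernel. Its constant depends on `S` and `a`, which is harmless:
it serves only for pieces on arcs whose length h can be chosen as small as needed afterwards. -/
lemma norm_fourierMultiplier_atom_le (S : Finset ℤ) (a : ℤ → ℂ)
    (hb : Integrable b volume) (hb0 : ∫ y, b y = 0)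
    (hbs : ∀ y, b y ≠ 0 → ‖y - c‖ ≤ h) (x : UnitAddCircle) :
    ‖fourierMultiplier S a b x‖
      ≤ (∑ t ∈ S, ‖a t‖ * (2 * Real.pi * |(t : ℝ)|)) * h * ∫ y, ‖b y‖ := by
  rw [fourierMultiplier_eq_of_integral_eq_zero S a hb hb0 c]
  rw [← integral_const_mul]
  refine norm_integral_le_of_norm_le (hb.norm.const_mul _) (ae_of_all _ fun y => ?_)
  rw [norm_mul]
  by_cases hy : b y = 0
  · simp [hy]
  · gcongr
    have e : x - y = (x - c) - (y - c) := by abel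
    rw [e, trigPoly_translate_sub, trigPoly, Finset.sum_mul]
    refine (norm_sum_le _ _).trans (Finset.sum_le_sum fun t _ => ?_)
    rw [norm_mul, norm_mul, norm_fourier_apply, mul_one, mul_assoc]
    gcongr
    refine (norm_fourier_sub_one_le _ _).trans ?_
    rw [norm_neg]
    gcongr
    exact hbs y hy

/-- Subtract k(x - c) using the mean zero condition, exchange integrals, and apply the Hörmander
condition to the translation by y - c. The constant is independent of `S`. -/
lemma IsDiscreteMarcinkiewicz.setIntegral_norm_atom_le {A : ℝ} (hA : 0 < A)
    (ha : IsDiscreteMarcinkiewicz A a) (hS : ∀ t ∉ S, a t = 0) (hh : 0 < h)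
    (hb : Integrable b volume) (hb0 : ∫ y, b y = 0) (hbs : ∀ y, b y ≠ 0 → ‖y - c‖ ≤ h) :
    ∫ x in {x | 2 * h ≤ ‖x - c‖}, ‖fourierMultiplier S a b x‖ ≤ 9600 * A * ∫ y, ‖b y‖ := by
  have hc := continuous_trigPoly S a
  set k : UnitAddCircle → UnitAddCircle → ℝ :=
    fun x y => ‖trigPoly S a (x - y) - trigPoly S a (x - c)‖ with hk
  have hkc : Continuous (Function.uncurry k) := by
    simp only [hk, Function.uncurry_def]; fun_prop
  have hprod : Integrable (Function.uncurry fun x y => k x y * ‖b y‖)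
      ((volume.restrict {x | 2 * h ≤ ‖x - c‖}).prod volume) := by
    obtain ⟨C, hC⟩ := (isCompact_univ (X := UnitAddCircle × UnitAddCircle)).exists_bound_of_continuousOn
      hkc.continuousOn
    exact (hb.norm.comp_snd _).bdd_mul (c := C) hkc.aestronglyMeasurable
      (ae_of_all _ fun x => hC x trivial)
  calc ∫ x in {x | 2 * h ≤ ‖x - c‖}, ‖fourierMultiplier S a b x‖
      ≤ ∫ x in {x | 2 * h ≤ ‖x - c‖}, ∫ y, k x y * ‖b y‖ := by
        refine integral_mono
          (continuous_fourierMultiplier S a b).norm.integrable_unitAddCircle.integrableOn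
          hprod.integral_prod_left fun x => ?_
        beta_reduce
        rw [fourierMultiplier_eq_of_integral_eq_zero S a hb hb0 c]
        refine (norm_integral_le_integral_norm _).trans_eq ?_
        simp only [hk, norm_mul]
    _ = ∫ y, (∫ x in {x | 2 * h ≤ ‖x - c‖}, k x y) * ‖b y‖ := by
        rw [integral_integral_swap hprod]
        simp_rw [integral_mul_const]
    _ ≤ ∫ y, (9600 * A) * ‖b y‖ := by
        refine integral_mono ?_ (hb.norm.const_mul _) fun y => ?_
        · have := hprod.integral_prod_right
          simpa only [Function.uncurry_apply_pair, integral_mul_const] using this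
        · beta_reduce
          by_cases hy : b y = 0
          · simp [hy]
          · gcongr
            have hm : MeasurableSet {x : UnitAddCircle | 2 * h ≤ ‖x - c‖} :=
              measurableSet_le measurable_const (by fun_prop)
            have h1 := ha.integral_translate_sub_le hA hS hh (hbs y hy)
            rw [← integral_indicator (measurableSet_le_norm_unitAddCircle _),
              ← integral_sub_right_eq_self _ c] at h1
            rw [← integral_indicator hm]
            refine le_of_eq_of_le (integral_congr_ae (ae_of_all _ fun x => ?_)) h1
            by_cases hx : 2 * h ≤ ‖x - c‖
            · simp only [Set.indicator, Set.mem_ofPred_eq, hx, if_true, hk]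
              congr 3; abel
            · simp only [Set.indicator, Set.mem_ofPred_eq, hx, if_false]
    _ = _ := integral_const_mul _ _

end atom

/-- The weak type `(1,1)` inequality for multipliers with finitely supported coefficients. -/
theorem IsDiscreteMarcinkiewicz.weak_type_one_one {A : ℝ} (hA : 0 < A) {S : Finset ℤ}
    {a : ℤ → ℂ} (ha : IsDiscreteMarcinkiewicz A a) (hS : ∀ t ∉ S, a t = 0)
    {f : UnitAddCircle → ℂ} (hf : Integrable f volume) {s : ℝ} (hs : 0 < s) :
    s * volume.real {x | s < ‖fourierMultiplier S a f x‖}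
      ≤ (4 + 8 * A ^ 2 + 76800 * A) * ∫ x, ‖f x‖ := by
  classical
  set I := ∫ x, ‖f x‖ with hI
  have hI0 : 0 ≤ I := integral_nonneg fun x => norm_nonneg _
  -- If s < I the claim is trivial because the circle has measure 1. Otherwise the whole circle has
  -- average at most s and can start the bisection.
  rcases lt_or_ge s I with hsI | hIs
  · have h1 : volume.real {x | s < ‖fourierMultiplier S a f x‖} ≤ 1 := measureReal_le_one
    have h2 : 1 ≤ 4 + 8 * A ^ 2 + 76800 * A := by nlinarith
    calc _ ≤ s * 1 := by gcongr
      _ ≤ 1 * I := by linarith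
      _ ≤ _ := by gcongr
  set Lip := ∑ t ∈ S, ‖a t‖ * (2 * Real.pi * |(t : ℝ)|) with hLip
  have hLip0 : 0 ≤ Lip := Finset.sum_nonneg fun t _ => by have := Real.pi_pos; positivity
  -- So many bisections that the bad parts on arcs of length at most 2^(-n) contribute together at
  -- most s/4 at every point.
  obtain ⟨n, hn⟩ : ∃ n : ℕ, Lip * (1 / 2 ^ n) * (2 * I) ≤ s / 4 := by
    obtain ⟨n, hn⟩ := pow_unbounded_of_one_lt (Lip * (2 * I) / (s / 4)) (one_lt_two)
    refine ⟨n, ?_⟩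
    rw [div_lt_iff₀ (by positivity)] at hn
    have e : Lip * (1 / 2 ^ n) * (2 * I) = Lip * (2 * I) / 2 ^ n := by ring
    rw [e, div_le_iff₀ (by positivity)]
    linarith
  obtain ⟨Q, hQ1, hQ2, hQ3, hQ4⟩ := exists_stopping_arcs hf.norm (fun x => norm_nonneg _) (s := s) n
    le_rfl one_pos (zero_add 1).le (by rw [arc_zero_one, setIntegral_univ]; linarith)
  rw [arc_zero_one] at hQ3
  have hsum : ∀ u : UnitAddCircle → ℝ, Integrable u volume →
      ∫ x, u x = ∑ p ∈ Q, ∫ x in arc p.1 p.2, u x := by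
    intro u hu
    rw [← setIntegral_univ, ← hQ3]
    exact integral_biUnion_finset Q (fun p _ => measurableSet_arc _ _) hQ2
      fun p _ => hu.integrableOn
  have hvol : ∀ p ∈ Q, volume.real (arc p.1 p.2) = p.2 := fun p hp =>
    volume_real_arc (hQ1 p hp).1 (hQ1 p hp).2.1.le (hQ1 p hp).2.2
  have hpos : ∀ p ∈ Q, 0 < p.2 := fun p hp => (hQ1 p hp).2.1
  set avg : ℝ × ℝ → ℂ := fun p => (p.2 : ℂ)⁻¹ * ∫ x in arc p.1 p.2, f x with havg
  have havg_mul : ∀ p ∈ Q, p.2 * ‖avg p‖ ≤ ∫ x in arc p.1 p.2, ‖f x‖ := by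
    intro p hp
    have hp0 := hpos p hp
    rw [havg]
    dsimp only
    rw [norm_mul, norm_inv, Complex.norm_real, Real.norm_of_nonneg hp0.le,
      mul_inv_cancel_left₀ hp0.ne']
    exact norm_integral_le_integral_norm _
  have havg_le : ∀ p ∈ Q, ‖avg p‖ ≤ 2 * s := by
    intro p hp
    have h := (havg_mul p hp).trans (hQ4 p hp).1
    have hp0 := hpos p hp
    nlinarith
  -- The good part takes averages on all arcs, including the short ones where the bisection simply
  -- ran out. This gives |g| ≤ 2s everywhere with no appeal to Lebesgue differentiation.
  set g : UnitAddCircle → ℂ := ∑ p ∈ Q, (arc p.1 p.2).indicator fun _ => avg p with hg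
  set b : ℝ × ℝ → UnitAddCircle → ℂ := fun p => (arc p.1 p.2).indicator fun x => f x - avg p with hb
  have hb_int : ∀ p, Integrable (b p) volume := fun p =>
    (hf.sub (integrable_const _)).indicator (measurableSet_arc _ _)
  have hg_meas : Measurable g := by
    have : g = fun x => ∑ p ∈ Q, (arc p.1 p.2).indicator (fun _ => avg p) x := by
      funext x; rw [hg, Finset.sum_apply]
    rw [this]
    exact Finset.measurable_sum _ fun p _ =>
      measurable_const.indicator (measurableSet_arc p.1 p.2)
  have hg_arc : ∀ p ∈ Q, ∀ x ∈ arc p.1 p.2, g x = avg p := by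
    intro p hp x hx
    rw [hg, Finset.sum_apply, Finset.sum_eq_single p, Set.indicator_of_mem hx]
    · intro q hq hqp
      exact Set.indicator_of_notMem (fun hxq =>
        Set.disjoint_left.1 (hQ2 hq hp hqp) hxq hx) _
    · exact fun h => absurd hp h
  have hcover : ∀ x, ∃ p ∈ Q, x ∈ arc p.1 p.2 := by
    intro x
    have : x ∈ ⋃ p ∈ Q, arc p.1 p.2 := hQ3 ▸ Set.mem_univ x
    simpa only [Set.mem_iUnion, exists_prop] using this
  have hg_le : ∀ x, ‖g x‖ ≤ 2 * s := by
    intro x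
    obtain ⟨p, hp, hx⟩ := hcover x
    rw [hg_arc p hp x hx]; exact havg_le p hp
  have hfgb : f = g + ∑ p ∈ Q, b p := by
    funext x
    obtain ⟨p, hp, hx⟩ := hcover x
    rw [Pi.add_apply, hg_arc p hp x hx, Finset.sum_apply, Finset.sum_eq_single p]
    · simp only [hb, Set.indicator_of_mem hx]; ring
    · intro q hq hqp
      exact Set.indicator_of_notMem (fun hxq =>
        Set.disjoint_left.1 (hQ2 hq hp hqp) hxq hx) _
    · exact fun h => absurd hp h
  have hb0 : ∀ p ∈ Q, ∫ x, b p x = 0 := by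
    intro p hp
    have hp0 : (p.2 : ℂ) ≠ 0 := by exact_mod_cast (hpos p hp).ne'
    simp only [hb]
    rw [integral_indicator (measurableSet_arc _ _), integral_sub hf.integrableOn
      (integrable_const _), setIntegral_const, hvol p hp, havg, Complex.real_smul,
      mul_inv_cancel_left₀ hp0, sub_self]
  have hb_supp : ∀ p, ∀ y, b p y ≠ 0 → ‖y - (p.1 : UnitAddCircle)‖ ≤ p.2 := by
    intro p y hy
    exact norm_sub_le_of_mem_arc (Set.mem_of_indicator_ne_zero hy)
  have hb_norm : ∀ p ∈ Q, ∫ x, ‖b p x‖ ≤ 2 * ∫ x in arc p.1 p.2, ‖f x‖ := by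
    intro p hp
    have e : ∀ x, ‖b p x‖ = (arc p.1 p.2).indicator (fun x => ‖f x - avg p‖) x := fun x =>
      norm_indicator_eq_indicator_norm _ _
    simp_rw [e]
    rw [integral_indicator (measurableSet_arc _ _)]
    calc ∫ x in arc p.1 p.2, ‖f x - avg p‖ ≤ ∫ x in arc p.1 p.2, (‖f x‖ + ‖avg p‖) :=
          integral_mono (hf.sub (integrable_const _)).norm.integrableOn
            (hf.norm.add (integrable_const _)).integrableOn fun x => norm_sub_le _ _
      _ = (∫ x in arc p.1 p.2, ‖f x‖) + p.2 * ‖avg p‖ := by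
          rw [integral_add hf.norm.integrableOn (integrable_const _), setIntegral_const, hvol p hp,
            smul_eq_mul]
      _ ≤ _ := by linarith [havg_mul p hp]
  have hg_mem : MemLp g 2 volume := MemLp.of_bound hg_meas.aestronglyMeasurable (2 * s)
    (ae_of_all _ hg_le)
  have hg_int : Integrable g volume := hg_mem.integrable one_le_two
  have hg_sq : ∫ x, ‖g x‖ ^ 2 ≤ 2 * s * I := by
    rw [hsum _ ((memLp_two_iff_integrable_sq_norm hg_mem.1).1 hg_mem), hI, hsum _ hf.norm,
      Finset.mul_sum]
    refine Finset.sum_le_sum fun p hp => ?_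
    rw [setIntegral_congr_fun (measurableSet_arc _ _) (g := fun _ => ‖avg p‖ ^ 2)
      (fun x hx => by simp only [hg_arc p hp x hx]), setIntegral_const, hvol p hp, smul_eq_mul]
    calc p.2 * ‖avg p‖ ^ 2 = ‖avg p‖ * (p.2 * ‖avg p‖) := by ring
      _ ≤ (2 * s) * ∫ x in arc p.1 p.2, ‖f x‖ := by
          have := hpos p hp
          gcongr
          · exact havg_le p hp
          · exact havg_mul p hp
  -- The arcs selected because the average exceeds s. Their total length is at most I/s, so their
  -- enlargements can be discarded; the arcs outside `R` have length at most 2^(-n).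
  set R := Q.filter fun p => s * p.2 < ∫ x in arc p.1 p.2, ‖f x‖ with hR
  have hRQ : R ⊆ Q := Finset.filter_subset _ _
  set far : ℝ × ℝ → Set UnitAddCircle := fun p => {x | 2 * p.2 ≤ ‖x - (p.1 : UnitAddCircle)‖}
    with hfar
  have hfar_meas : ∀ p, MeasurableSet (far p) := fun p =>
    measurableSet_le measurable_const (by fun_prop)
  set E := ⋃ p ∈ R, (far p)ᶜ with hE
  have hE_vol : volume.real E ≤ 4 * I / s := by
    calc volume.real E ≤ ∑ p ∈ R, volume.real (far p)ᶜ := measureReal_biUnion_finset_le _ _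
      _ ≤ ∑ p ∈ R, (4 / s) * ∫ x in arc p.1 p.2, ‖f x‖ := by
          refine Finset.sum_le_sum fun p hp => ?_
          have hp' := (Finset.mem_filter.1 hp).2
          have hp0 := hpos p (hRQ hp)
          have hsub : (far p)ᶜ ⊆ Metric.closedBall (p.1 : UnitAddCircle) (2 * p.2) := by
            intro x hx
            rw [Metric.mem_closedBall, dist_eq_norm]
            have hx : ¬ 2 * p.2 ≤ ‖x - (p.1 : UnitAddCircle)‖ := hx
            exact (not_le.1 hx).le
          calc volume.real (far p)ᶜ
              ≤ volume.real (Metric.closedBall (p.1 : UnitAddCircle) (2 * p.2)) :=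
                measureReal_mono hsub
            _ = min 1 (2 * (2 * p.2)) := by
                rw [Measure.real, AddCircle.volume_closedBall, ENNReal.toReal_ofReal (by positivity)]
            _ ≤ 2 * (2 * p.2) := min_le_right _ _
            _ = (4 / s) * (s * p.2) := by field_simp; ring
            _ ≤ _ := by gcongr
      _ ≤ ∑ p ∈ Q, (4 / s) * ∫ x in arc p.1 p.2, ‖f x‖ :=
          Finset.sum_le_sum_of_subset_of_nonneg hRQ fun p _ _ =>
            mul_nonneg (by positivity) (setIntegral_nonneg (measurableSet_arc _ _)
              fun x _ => norm_nonneg _)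
      _ = 4 * I / s := by rw [← Finset.mul_sum, ← hsum _ hf.norm]; ring
  set H : UnitAddCircle → ℝ := fun x =>
    ∑ p ∈ R, (far p).indicator (fun x => ‖fourierMultiplier S a (b p) x‖) x with hH
  have hTi : ∀ p, Integrable (fun x => ‖fourierMultiplier S a (b p) x‖) volume := fun p =>
    (continuous_fourierMultiplier S a (b p)).norm.integrable_unitAddCircle
  have hH_int : Integrable H volume :=
    integrable_finsetSum _ fun p _ => (hTi p).indicator (hfar_meas p)
  have hH0 : ∀ x, 0 ≤ H x := fun x =>
    Finset.sum_nonneg fun p _ => Set.indicator_nonneg (fun x _ => norm_nonneg _) _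
  have hH_le : ∫ x, H x ≤ 19200 * A * I := by
    calc ∫ x, H x = ∑ p ∈ R, ∫ x in far p, ‖fourierMultiplier S a (b p) x‖ := by
          simp only [hH]
          rw [integral_finsetSum _ fun p _ => (hTi p).indicator (hfar_meas p)]
          exact Finset.sum_congr rfl fun p _ => integral_indicator (hfar_meas p)
      _ ≤ ∑ p ∈ R, 19200 * A * ∫ x in arc p.1 p.2, ‖f x‖ := by
          refine Finset.sum_le_sum fun p hp => ?_
          have h1 := ha.setIntegral_norm_atom_le hA hS (hpos p (hRQ hp)) (hb_int p)
            (hb0 p (hRQ hp)) (hb_supp p)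
          refine h1.trans ?_
          calc 9600 * A * ∫ x, ‖b p x‖ ≤ 9600 * A * (2 * ∫ x in arc p.1 p.2, ‖f x‖) := by
                gcongr; exact hb_norm p (hRQ hp)
            _ = _ := by ring
      _ ≤ ∑ p ∈ Q, 19200 * A * ∫ x in arc p.1 p.2, ‖f x‖ :=
          Finset.sum_le_sum_of_subset_of_nonneg hRQ fun p _ _ =>
            mul_nonneg (by positivity) (setIntegral_nonneg (measurableSet_arc _ _)
              fun x _ => norm_nonneg _)
      _ = _ := by rw [← Finset.mul_sum, ← hsum _ hf.norm]
  have hsmall : ∀ x, ∑ p ∈ Q \ R, ‖fourierMultiplier S a (b p) x‖ ≤ s / 4 := by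
    intro x
    calc ∑ p ∈ Q \ R, ‖fourierMultiplier S a (b p) x‖
        ≤ ∑ p ∈ Q \ R, Lip * (1 / 2 ^ n) * (2 * ∫ x in arc p.1 p.2, ‖f x‖) := by
          refine Finset.sum_le_sum fun p hp => ?_
          obtain ⟨hpQ, hpR⟩ := Finset.mem_sdiff.1 hp
          have hp2 : p.2 ≤ 1 / 2 ^ n := (hQ4 p hpQ).2.resolve_left fun h =>
            hpR (Finset.mem_filter.2 ⟨hpQ, h⟩)
          refine (norm_fourierMultiplier_atom_le S a (hb_int p) (hb0 p hpQ) (hb_supp p) x).trans ?_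
          gcongr
          exact hb_norm p hpQ
      _ ≤ ∑ p ∈ Q, Lip * (1 / 2 ^ n) * (2 * ∫ x in arc p.1 p.2, ‖f x‖) :=
          Finset.sum_le_sum_of_subset_of_nonneg Finset.sdiff_subset fun p _ _ =>
            mul_nonneg (by positivity) (mul_nonneg zero_le_two
              (setIntegral_nonneg (measurableSet_arc _ _) fun x _ => norm_nonneg _))
      _ = Lip * (1 / 2 ^ n) * (2 * I) := by
          rw [← Finset.mul_sum, ← Finset.mul_sum, ← hsum _ hf.norm]
      _ ≤ s / 4 := hn
  -- Off `E` the budget s splits as s/2 for the good part (Chebyshev in L², giving 8A²), s/4 for the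
  -- bad parts on `R` (Chebyshev in L¹, giving 4 · 19200A) and s/4 for the short arcs, which never
  -- exceed it. The set `E` accounts for the constant 4.
  have hincl : {x | s < ‖fourierMultiplier S a f x‖}
      ⊆ ({x | (s / 2) ^ 2 ≤ ‖fourierMultiplier S a g x‖ ^ 2} ∪ E) ∪ {x | s / 4 ≤ H x} := by
    intro x hx
    by_contra hcon
    simp only [Set.mem_union, Set.mem_ofPred_eq, not_or, not_le] at hcon
    obtain ⟨⟨h1, h2⟩, h3⟩ := hcon
    have h1' : ‖fourierMultiplier S a g x‖ < s / 2 := lt_of_pow_lt_pow_left₀ 2 (by positivity) h1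
    have hbad : ∑ p ∈ R, ‖fourierMultiplier S a (b p) x‖ = H x := by
      refine Finset.sum_congr rfl fun p hp => ?_
      have hxp : x ∈ far p := by
        by_contra hxp
        exact h2 (Set.mem_biUnion hp hxp)
      rw [Set.indicator_of_mem hxp]
    have hx : s < ‖fourierMultiplier S a f x‖ := hx
    have hT : ‖fourierMultiplier S a f x‖ ≤ ‖fourierMultiplier S a g x‖
        + (∑ p ∈ Q \ R, ‖fourierMultiplier S a (b p) x‖ + H x) := by
      rw [hfgb, fourierMultiplier_add S a hg_int (integrable_finsetSum' _ fun p _ => hb_int p),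
        fourierMultiplier_sum S a Q fun p _ => hb_int p, ← hbad, Finset.sum_sdiff hRQ]
      exact (norm_add_le _ _).trans (by gcongr; exact norm_sum_le _ _)
    linarith [hsmall x]
  have hM1 : (s / 2) ^ 2 * volume.real {x | (s / 2) ^ 2 ≤ ‖fourierMultiplier S a g x‖ ^ 2}
      ≤ A ^ 2 * (2 * s * I) := by
    refine (mul_meas_ge_le_integral_of_nonneg (ae_of_all _ fun x => sq_nonneg _)
      ((continuous_fourierMultiplier S a g).norm.pow 2).integrable_unitAddCircle _).trans ?_
    refine (integral_norm_sq_fourierMultiplier_le ha.bound hg_mem).trans ?_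
    gcongr
  have hM2 := mul_meas_ge_le_integral_of_nonneg (ae_of_all _ hH0) hH_int (s / 4)
  have hM1' : s * volume.real {x | (s / 2) ^ 2 ≤ ‖fourierMultiplier S a g x‖ ^ 2}
      ≤ 8 * A ^ 2 * I := by
    have : s * (s * volume.real {x | (s / 2) ^ 2 ≤ ‖fourierMultiplier S a g x‖ ^ 2})
      ≤ s * (8 * A ^ 2 * I) := by linarith
    exact le_of_mul_le_mul_left this hs
  have hE' : s * volume.real E ≤ 4 * I := by
    rw [le_div_iff₀ hs] at hE_vol; linarith
  calc s * volume.real {x | s < ‖fourierMultiplier S a f x‖}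
      ≤ s * (volume.real {x | (s / 2) ^ 2 ≤ ‖fourierMultiplier S a g x‖ ^ 2} + volume.real E
          + volume.real {x | s / 4 ≤ H x}) := by
        gcongr
        refine (measureReal_mono hincl).trans ((measureReal_union_le _ _).trans ?_)
        gcongr
        exact measureReal_union_le _ _
    _ ≤ _ := by linarith

/-! ### Modulation, sharp truncation and uniform bounds for partial sums. -/

/-- The constant in the weak type `(1,1)` inequality for the coefficient bound `A`. -/
noncomputable def weakTypeConst (A : ℝ) : ℝ := 4 + 8 * A ^ 2 + 76800 * A

/-- Modulation does not affect the weak type `(1,1)` inequality. -/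
lemma IsDiscreteMarcinkiewicz.weak_type_one_one_of_shift {A : ℝ} (hA : 0 < A) {S : Finset ℤ}
    {a : ℤ → ℂ} (k : ℤ) (ha : IsDiscreteMarcinkiewicz A fun t => a (t + k))
    (hS : ∀ t ∉ S, a t = 0)
    {f : UnitAddCircle → ℂ} (hf : Integrable f volume) {s : ℝ} (hs : 0 < s) :
    s * volume.real {x | s < ‖fourierMultiplier S a f x‖} ≤ weakTypeConst A * ∫ x, ‖f x‖ := by
  classical
  set f' : UnitAddCircle → ℂ := fun x => fourier (-k) x * f x with hf'
  have hf'i : Integrable f' volume := Integrable.mul_continuous_unitAddCircle hf (by fun_prop)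
  have hcoef : ∀ t, fourierCoeff f' t = fourierCoeff f (t + k) := by
    intro t
    rw [fourierCoeff_eq_integral, fourierCoeff_eq_integral]
    congr 1; funext y
    rw [neg_add, fourier_add, hf']; ring
  set S' := S.image (fun t => t - k) with hS'
  have hS'0 : ∀ t ∉ S', a (t + k) = 0 := fun t ht => hS _ fun h =>
    ht (Finset.mem_image.2 ⟨t + k, h, by ring⟩)
  have hT : ∀ x, fourierMultiplier S a f x
      = fourier k x * fourierMultiplier S' (fun t => a (t + k)) f' x := by
    intro x
    simp only [fourierMultiplier, trigPoly, hcoef, hS']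
    rw [Finset.sum_image (fun _ _ _ _ h => by simpa using h), Finset.mul_sum]
    refine Finset.sum_congr rfl fun t _ => ?_
    have e : (fourier t x : ℂ) = fourier k x * fourier (t - k) x := by
      rw [← fourier_add]; congr 2; ring
    rw [sub_add_cancel, e]; ring
  have hn : ∀ x, ‖f' x‖ = ‖f x‖ := fun x => by
    simp only [hf', norm_mul, norm_fourier_apply, one_mul]
  have := ha.weak_type_one_one hA hS'0 hf'i hs
  simp only [hn] at this
  simp only [hT, norm_mul, norm_fourier_apply, one_mul]
  exact this

lemma IsDiscreteMarcinkiewicz.conj {A : ℝ} {a : ℤ → ℂ} (ha : IsDiscreteMarcinkiewicz A a) :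
    IsDiscreteMarcinkiewicz A fun t => conj (a t) where
  bound t := by rw [RCLike.norm_conj]; exact ha.bound t
  diff_bound t := by rw [← map_sub, RCLike.norm_conj]; exact ha.diff_bound t

section truncation

variable {A : ℝ} {a : ℤ → ℂ} {N : ℕ}

/-- The product of the coefficients with the Fejér tent. -/
noncomputable def fejerPart (a : ℤ → ℂ) (N : ℕ) (t : ℤ) : ℂ :=
  if |t| ≤ N then a t * ((1 - |(t : ℝ)| / N : ℝ) : ℂ) else 0

/-- The product of the coefficients with the ramp on `[0, N]`. -/
noncomputable def rightRampPart (a : ℤ → ℂ) (N : ℕ) (t : ℤ) : ℂ :=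
  if 0 ≤ t ∧ t ≤ N then a t * ((t / N : ℝ) : ℂ) else 0

/-- The product of the coefficients with the ramp on `[-N, 0]`. -/
noncomputable def leftRampPart (a : ℤ → ℂ) (N : ℕ) (t : ℤ) : ℂ :=
  if -(N : ℤ) ≤ t ∧ t ≤ 0 then a t * ((-t / N : ℝ) : ℂ) else 0

/-- The indicator of |t| ≤ N is the tent 1 - |t|/N plus the ramps t/N and -t/N on the two sides. The
tent has no jump and each ramp has just one, so one modulation per ramp suffices. -/
lemma fejerPart_add_ramps (a : ℤ → ℂ) {N : ℕ} {t : ℤ} (ht : |t| ≤ N) :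
    fejerPart a N t + (rightRampPart a N t + leftRampPart a N t) = a t := by
  have ht' := abs_le.1 ht
  simp only [fejerPart, rightRampPart, leftRampPart, if_pos ht]
  rcases lt_trichotomy t 0 with h | h | h
  · rw [if_neg (by omega), if_pos (by omega), abs_of_neg (by exact_mod_cast h)]
    push_cast; ring
  · subst h; simp
  · rw [if_pos (by omega), if_neg (by omega), abs_of_pos (by exact_mod_cast h)]
    push_cast; ring

lemma norm_mul_ofReal_le (ha : IsDiscreteMarcinkiewicz A a) (t : ℤ) {c : ℝ}
    (h0 : 0 ≤ c) (h1 : c ≤ 1) : ‖a t * (c : ℂ)‖ ≤ A := by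
  rw [norm_mul, Complex.norm_real, Real.norm_of_nonneg h0]
  calc ‖a t‖ * c ≤ A * 1 := by
        gcongr
        · exact (norm_nonneg _).trans (ha.bound t)
        · exact ha.bound t
    _ = A := mul_one A

/-- The tent has slope 1/N and |t| ≤ N on its support, so the product rule costs only one extra A.
It vanishes at ±N, so the cutoff there creates no jump. -/
lemma isDiscreteMarcinkiewicz_fejerPart (ha : IsDiscreteMarcinkiewicz A a) (hN : 1 ≤ N) :
    IsDiscreteMarcinkiewicz (2 * A) (fejerPart a N) := by
  have hA : 0 ≤ A := (norm_nonneg _).trans (ha.bound 0)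
  have hN0 : (0 : ℝ) < N := by exact_mod_cast hN
  refine ⟨fun t => ?_, fun t => ?_⟩
  · unfold fejerPart
    split_ifs with h
    · have h' : |(t : ℝ)| / N ≤ 1 := (div_le_one hN0).2 (by exact_mod_cast h)
      have h0 : 0 ≤ |(t : ℝ)| / N := by positivity
      exact (norm_mul_ofReal_le ha t (by linarith) (by linarith)).trans (by linarith)
    · rw [norm_zero]; positivity
  · by_cases h : |t| ≤ N
    · have h' : |(t : ℝ)| / N ≤ 1 := (div_le_one hN0).2 (by exact_mod_cast h)
      have h0 : 0 ≤ |(t : ℝ)| / N := by positivity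
      set w : ℝ := if |t + 1| ≤ N then 1 - |((t + 1 : ℤ) : ℝ)| / N else 0 with hw
      have e1 : fejerPart a N (t + 1) = a (t + 1) * (w : ℂ) := by
        simp only [fejerPart, hw]; split_ifs <;> simp
      have hwd : |w - (1 - |(t : ℝ)| / N)| ≤ 1 / N := by
        have hlip : |(|((t + 1 : ℤ) : ℝ)| / N - |(t : ℝ)| / N)| ≤ 1 / N := by
          rw [← sub_div, abs_div, abs_of_pos hN0]
          gcongr
          refine (abs_abs_sub_abs_le_abs_sub _ _).trans ?_
          push_cast; simp
        rw [hw]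
        split_ifs with h2
        · rw [← abs_neg]
          refine le_of_eq_of_le ?_ hlip
          congr 1; ring
        · have h3 : |((t : ℤ) : ℝ)| = N := by
            have : |t| = N := by
              have := abs_le.1 h
              rw [not_le, lt_abs] at h2
              rw [abs_eq (by omega)]; omega
            exact_mod_cast this
          rw [h3, div_self hN0.ne']; simp
      have e2 : fejerPart a N t = a t * ((1 - |(t : ℝ)| / N : ℝ) : ℂ) := if_pos h
      have e3 : a (t + 1) * (w : ℂ) - a t * ((1 - |(t : ℝ)| / N : ℝ) : ℂ)
          = a (t + 1) * ((w - (1 - |(t : ℝ)| / N) : ℝ) : ℂ)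
            + (a (t + 1) - a t) * ((1 - |(t : ℝ)| / N : ℝ) : ℂ) := by
        push_cast; ring
      rw [e1, e2, e3]
      calc |(t : ℝ)| * ‖a (t + 1) * ((w - (1 - |(t : ℝ)| / N) : ℝ) : ℂ)
            + (a (t + 1) - a t) * ((1 - |(t : ℝ)| / N : ℝ) : ℂ)‖
          ≤ |(t : ℝ)| * (A * (1 / N) + ‖a (t + 1) - a t‖ * 1) := by
            gcongr
            refine (norm_add_le _ _).trans ?_
            rw [norm_mul, norm_mul, Complex.norm_real, Complex.norm_real, Real.norm_eq_abs,
              Real.norm_eq_abs]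
            gcongr
            · exact ha.bound _
            · rw [abs_of_nonneg (by linarith)]; linarith
        _ = A * (|(t : ℝ)| / N) + |(t : ℝ)| * ‖a (t + 1) - a t‖ := by ring
        _ ≤ A * 1 + A := by
            gcongr
            exact ha.diff_bound t
        _ = 2 * A := by ring
    · have e1 : fejerPart a N t = 0 := if_neg h
      have e2 : fejerPart a N (t + 1) = 0 := by
        unfold fejerPart
        split_ifs with h2
        · have h3 : |((t + 1 : ℤ) : ℝ)| = N := by
            have : |t + 1| = N := by
              have := abs_le.1 h2
              rw [not_le, lt_abs] at h
              rw [abs_eq (by omega)]; omega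
            exact_mod_cast this
          rw [h3, div_self hN0.ne']; simp
        · rfl
      rw [e1, e2]; simp; positivity

lemma norm_rightRampPart_le (ha : IsDiscreteMarcinkiewicz A a) (hN : 1 ≤ N) (t : ℤ) :
    ‖rightRampPart a N t‖ ≤ A := by
  have hN0 : (0 : ℝ) < N := by exact_mod_cast hN
  unfold rightRampPart
  split_ifs with h
  · exact norm_mul_ofReal_le ha t (div_nonneg (by exact_mod_cast h.1) hN0.le)
      ((div_le_one hN0).2 (by exact_mod_cast h.2))
  · rw [norm_zero]; exact (norm_nonneg _).trans (ha.bound 0)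

lemma norm_leftRampPart_le (ha : IsDiscreteMarcinkiewicz A a) (hN : 1 ≤ N) (t : ℤ) :
    ‖leftRampPart a N t‖ ≤ A := by
  have hN0 : (0 : ℝ) < N := by exact_mod_cast hN
  unfold leftRampPart
  split_ifs with h
  · refine norm_mul_ofReal_le ha t (div_nonneg ?_ hN0.le) ((div_le_one hN0).2 ?_)
    · have : (0 : ℤ) ≤ -t := by omega
      exact_mod_cast this
    · have : -t ≤ (N : ℤ) := by omega
      exact_mod_cast this
  · rw [norm_zero]; exact (norm_nonneg _).trans (ha.bound 0)

/-- After the shift the jump from N to N + 1 sits at t = 0, where the weight |t| kills it. Along the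
ramp, with u = t + N, the weight is at most N: the slope 1/N contributes A, and the factor u/N turns
N|a(u+1) - a(u)| into u|a(u+1) - a(u)| ≤ A. -/
lemma isDiscreteMarcinkiewicz_rightRampPart (ha : IsDiscreteMarcinkiewicz A a) (hN : 1 ≤ N) :
    IsDiscreteMarcinkiewicz (2 * A) fun t => rightRampPart a N (t + N) := by
  have hA : 0 ≤ A := (norm_nonneg _).trans (ha.bound 0)
  have hN0 : (0 : ℝ) < N := by exact_mod_cast hN
  refine ⟨fun t => (norm_rightRampPart_le ha hN _).trans (by linarith), fun t => ?_⟩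
  rcases le_or_gt 0 t with h | h
  · rcases h.eq_or_lt with h | h
    · rw [← h]; simp; positivity
    · rw [rightRampPart, rightRampPart, if_neg (by omega), if_neg (by omega)]; simp; positivity
  · rcases lt_or_ge (t + N) 0 with h2 | h2
    · have e1 : rightRampPart a N (t + N) = 0 := if_neg (by omega)
      have e2 : rightRampPart a N (t + 1 + N) = 0 := by
        by_cases h3 : t + 1 + N = 0
        · rw [h3]; simp [rightRampPart]
        · exact if_neg (by omega)
      rw [e1, e2]; simp; positivity
    · obtain ⟨u, hu⟩ : ∃ u, u = t + N := ⟨_, rfl⟩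
      have e0 : t + 1 + N = u + 1 := by omega
      have ht : t = u - N := by omega
      rw [e0, ← hu, rightRampPart, rightRampPart, if_pos (by omega), if_pos (by omega)]
      have e : a (u + 1) * (((u + 1 : ℤ) / N : ℝ) : ℂ) - a u * ((u / N : ℝ) : ℂ)
          = a (u + 1) * ((1 / N : ℝ) : ℂ) + (a (u + 1) - a u) * ((u / N : ℝ) : ℂ) := by
        push_cast; ring
      have hu0 : (0 : ℝ) ≤ u := by exact_mod_cast (by omega : (0 : ℤ) ≤ u)
      rw [e]
      have hd := ha.diff_bound u
      rw [abs_of_nonneg hu0] at hd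
      have ht' : |(t : ℝ)| ≤ N := by
        have : |t| ≤ (N : ℤ) := abs_le.2 (by omega)
        exact_mod_cast this
      calc |(t : ℝ)| * ‖a (u + 1) * ((1 / N : ℝ) : ℂ) + (a (u + 1) - a u) * ((u / N : ℝ) : ℂ)‖
          ≤ N * (A * (1 / N) + ‖a (u + 1) - a u‖ * (u / N)) := by
            gcongr
            refine (norm_add_le _ _).trans ?_
            rw [norm_mul, norm_mul, Complex.norm_real, Complex.norm_real,
              Real.norm_of_nonneg (by positivity), Real.norm_of_nonneg (by positivity)]
            gcongr
            exact ha.bound _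
        _ = A + u * ‖a (u + 1) - a u‖ := by field_simp
        _ ≤ 2 * A := by linarith

lemma isDiscreteMarcinkiewicz_leftRampPart (ha : IsDiscreteMarcinkiewicz A a) (hN : 1 ≤ N) :
    IsDiscreteMarcinkiewicz (2 * A) fun t => leftRampPart a N (t + -(N : ℤ)) := by
  have hA : 0 ≤ A := (norm_nonneg _).trans (ha.bound 0)
  have hN0 : (0 : ℝ) < N := by exact_mod_cast hN
  refine ⟨fun t => (norm_leftRampPart_le ha hN _).trans (by linarith), fun t => ?_⟩
  rcases lt_or_ge t 0 with h | h
  · have e1 : leftRampPart a N (t + -(N : ℤ)) = 0 := if_neg (by omega)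
    rw [e1, sub_zero]
    -- The jump of the left ramp lies between -1 and 0 after the shift. The forward difference sees
    -- it at t = -1, with weight 1 instead of 0, and the sup bound suffices.
    rcases eq_or_ne t (-1) with h2 | h2
    · subst h2
      have := norm_leftRampPart_le ha hN (-1 + 1 + -(N : ℤ))
      simp only [Int.reduceNeg, Int.cast_neg, Int.cast_one, abs_neg, abs_one, one_mul]
      linarith
    · rw [leftRampPart, if_neg (by omega)]; simp; positivity
  · rcases le_or_gt (N : ℤ) t with h2 | h2
    · have e1 : leftRampPart a N (t + 1 + -(N : ℤ)) = 0 := if_neg (by omega)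
      have e2 : leftRampPart a N (t + -(N : ℤ)) = 0 := by
        by_cases h3 : t + -(N : ℤ) = 0
        · rw [h3]; simp [leftRampPart]
        · exact if_neg (by omega)
      rw [e1, e2]; simp; positivity
    · obtain ⟨u, hu⟩ : ∃ u, u = t + -(N : ℤ) := ⟨_, rfl⟩
      have e0 : t + 1 + -(N : ℤ) = u + 1 := by omega
      have ht : t = u + N := by omega
      rw [e0, ← hu, leftRampPart, leftRampPart, if_pos (by omega), if_pos (by omega)]
      have e : a (u + 1) * ((-(u + 1 : ℤ) / N : ℝ) : ℂ) - a u * ((-u / N : ℝ) : ℂ)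
          = (a (u + 1) - a u) * ((-u / N : ℝ) : ℂ) - a (u + 1) * ((1 / N : ℝ) : ℂ) := by
        push_cast; ring
      have hu0 : (0 : ℝ) ≤ -u := by exact_mod_cast (by omega : (0 : ℤ) ≤ -u)
      rw [e]
      have hd := ha.diff_bound u
      rw [abs_of_nonpos (by linarith)] at hd
      have ht' : |(t : ℝ)| ≤ N := by
        have : |t| ≤ (N : ℤ) := abs_le.2 (by omega)
        exact_mod_cast this
      calc |(t : ℝ)| * ‖(a (u + 1) - a u) * ((-u / N : ℝ) : ℂ) - a (u + 1) * ((1 / N : ℝ) : ℂ)‖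
          ≤ N * (‖a (u + 1) - a u‖ * (-u / N) + A * (1 / N)) := by
            gcongr
            refine (norm_sub_le _ _).trans ?_
            rw [norm_mul, norm_mul, Complex.norm_real, Complex.norm_real,
              Real.norm_of_nonneg (by positivity), Real.norm_of_nonneg (by positivity)]
            gcongr
            exact ha.bound _
        _ = A + -u * ‖a (u + 1) - a u‖ := by field_simp; ring
        _ ≤ 2 * A := by linarith

/-- The weak type `(1,1)` inequality for symmetric partial sums, uniformly in `N`. -/
theorem IsDiscreteMarcinkiewicz.weak_type_partialSum (hA : 0 < A)
    (ha : IsDiscreteMarcinkiewicz A a) (hN : 1 ≤ N)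
    {f : UnitAddCircle → ℂ} (hf : Integrable f volume) {s : ℝ} (hs : 0 < s) :
    s * volume.real {x | s < ‖fourierMultiplier (Finset.Icc (-(N : ℤ)) N) a f x‖}
      ≤ 9 * weakTypeConst (2 * A) * ∫ x, ‖f x‖ := by
  set S := Finset.Icc (-(N : ℤ)) N with hS
  have hs3 : 0 < s / 3 := by positivity
  have hA2 : 0 < 2 * A := by positivity
  have h0 : ∀ t ∉ S, fejerPart a N t = 0 := fun t ht => if_neg fun h =>
    ht (Finset.mem_Icc.2 (abs_le.1 h))
  have h1 : ∀ t ∉ S, rightRampPart a N t = 0 := fun t ht => if_neg fun h =>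
    ht (Finset.mem_Icc.2 (by omega))
  have h2 : ∀ t ∉ S, leftRampPart a N t = 0 := fun t ht => if_neg fun h =>
    ht (Finset.mem_Icc.2 (by omega))
  have w0 := (isDiscreteMarcinkiewicz_fejerPart ha hN).weak_type_one_one hA2 h0 hf hs3
  have w1 := (isDiscreteMarcinkiewicz_rightRampPart ha hN).weak_type_one_one_of_shift hA2 N
    h1 hf hs3
  have w2 := (isDiscreteMarcinkiewicz_leftRampPart ha hN).weak_type_one_one_of_shift hA2 (-N)
    h2 hf hs3
  rw [← weakTypeConst] at w0
  have hT : ∀ x, fourierMultiplier S a f x = fourierMultiplier S (fejerPart a N) f x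
      + (fourierMultiplier S (rightRampPart a N) f x
        + fourierMultiplier S (leftRampPart a N) f x) := by
    intro x
    simp only [fourierMultiplier, trigPoly, ← Finset.sum_add_distrib]
    refine Finset.sum_congr rfl fun t ht => ?_
    have := fejerPart_add_ramps a (N := N) (t := t) (abs_le.2 (Finset.mem_Icc.1 ht))
    rw [← this]; ring
  have hincl : {x | s < ‖fourierMultiplier S a f x‖}
      ⊆ {x | s / 3 < ‖fourierMultiplier S (fejerPart a N) f x‖}
        ∪ ({x | s / 3 < ‖fourierMultiplier S (rightRampPart a N) f x‖}
          ∪ {x | s / 3 < ‖fourierMultiplier S (leftRampPart a N) f x‖}) := by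
    intro x hx
    by_contra hcon
    simp only [Set.mem_union, Set.mem_ofPred_eq, not_or, not_lt] at hcon
    have hx : s < ‖fourierMultiplier S a f x‖ := hx
    rw [hT] at hx
    have k1 := norm_add_le (fourierMultiplier S (fejerPart a N) f x)
      (fourierMultiplier S (rightRampPart a N) f x + fourierMultiplier S (leftRampPart a N) f x)
    have k2 := norm_add_le (fourierMultiplier S (rightRampPart a N) f x)
      (fourierMultiplier S (leftRampPart a N) f x)
    linarith [hcon.1, hcon.2.1, hcon.2.2]
  -- Three pieces, each at level s/3, account for the factor 9.
  have hv := (measureReal_mono (μ := volume) hincl).trans ((measureReal_union_le _ _).trans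
    (add_le_add_right (measureReal_union_le _ _) _))
  have := mul_le_mul_of_nonneg_left hv hs.le
  linarith

end truncation

/-! ### From the multiplier on the line to its integer samples. -/

/-- The integers sampled from a Marcinkiewicz multiplier satisfy the discrete condition. -/
lemma IsMarcinkiewiczMultiplier.exists_isDiscreteMarcinkiewicz {m : ℝ → ℂ}
    (hm : IsMarcinkiewiczMultiplier m) :
    ∃ A : ℝ, 0 < A ∧ IsDiscreteMarcinkiewicz A fun t : ℤ => m t := by
  obtain ⟨B, hB⟩ := hm.bounded
  obtain ⟨C, hC⟩ := hm.deriv_bound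
  have hC1 : ∀ t : ℝ, t ≠ 0 → ‖deriv m t‖ ≤ C / |t| := fun t ht => by
    simpa [iteratedDeriv_one] using hC 1 (by norm_num) t ht
  have hB0 : 0 ≤ B := (norm_nonneg _).trans (hB 0)
  have hC0 : 0 ≤ C := by
    have := (norm_nonneg _).trans (hC1 1 one_ne_zero)
    simpa using this
  have hdiff : ∀ t : ℝ, t ≠ 0 → DifferentiableAt ℝ m t := fun t ht =>
    ((hm.smooth.contDiffAt (isOpen_compl_singleton.mem_nhds ht)).differentiableAt (by simp))
  have mvt : ∀ t : ℤ, ∀ r : ℝ, 0 < r → (∀ u ∈ Set.Icc (t : ℝ) (t + 1), r ≤ |u|) →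
      ‖m ((t + 1 : ℤ) : ℝ) - m t‖ ≤ C / r := by
    intro t r hr hu
    have h0 : ∀ u ∈ Set.Icc (t : ℝ) (t + 1), u ≠ 0 := fun u hu' h => by
      have := hu u hu'
      rw [h, abs_zero] at this; linarith
    have := (convex_Icc (t : ℝ) (t + 1)).norm_image_sub_le_of_norm_deriv_le (f := m) (C := C / r)
      (fun u hu' => hdiff u (h0 u hu'))
      (fun u hu' => (hC1 u (h0 u hu')).trans (by gcongr; exact hu u hu'))
      (Set.left_mem_Icc.2 (by linarith)) (Set.right_mem_Icc.2 (by linarith))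
    push_cast
    simpa using this
  refine ⟨2 * B + 2 * C + 1, by positivity, fun t => (hB t).trans (by linarith), fun t => ?_⟩
  rcases lt_trichotomy t 0 with h | h | h
  -- For t = -1 the interval [t, t+1] reaches the origin, where `m` may be singular, so the sup
  -- bound replaces the mean value theorem. For t ≤ -2 the interval stays at distance at least |t|/2
  -- from 0.
  · rcases eq_or_ne t (-1) with h1 | h1
    · have := norm_sub_le (m ((t + 1 : ℤ) : ℝ)) (m t)
      have h2 := hB ((t + 1 : ℤ) : ℝ)
      have h3 := hB t
      have e : |(t : ℝ)| = 1 := by rw [h1]; simp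
      rw [e, one_mul]
      linarith
    · have ht : (t : ℝ) ≤ -2 := by exact_mod_cast (by omega : t ≤ -2)
      have := mvt t (-t / 2) (by linarith) fun u hu => by
        rw [abs_of_neg (by linarith [hu.2])]; linarith [hu.2]
      rw [le_div_iff₀ (by linarith)] at this
      rw [abs_of_neg (by linarith)]
      linarith
  · subst h; simp; positivity
  · have ht : (1 : ℝ) ≤ t := by exact_mod_cast h
    have := mvt t t (by linarith) fun u hu => by
      rw [abs_of_pos (by linarith [hu.1])]; exact hu.1
    rw [le_div_iff₀ (by linarith)] at this
    rw [abs_of_pos (by linarith)]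
    linarith

/-! ### Interpolation for 1 < p < 2. -/

lemma lintegral_indicator_rpow_lt_le {r F : ℝ} (hr : -1 < r) (hF : 0 ≤ F) :
    ∫⁻ t in Set.Ioi (0 : ℝ), (Set.Iio F).indicator (fun t => ENNReal.ofReal (t ^ r)) t
      ≤ ENNReal.ofReal (F ^ (r + 1) / (r + 1)) := by
  have hi : IntegrableOn (fun t : ℝ => t ^ r) (Set.Ioo 0 F) volume :=
    ((intervalIntegrable_iff_integrableOn_Ioc_of_le hF).1
      (intervalIntegral.intervalIntegrable_rpow' hr)).mono_set Set.Ioo_subset_Ioc_self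
  rw [lintegral_indicator measurableSet_Iio, Measure.restrict_restrict measurableSet_Iio,
    Set.inter_comm, Set.Ioi_inter_Iio, ← ofReal_integral_eq_lintegral_ofReal hi
      ((ae_restrict_iff' measurableSet_Ioo).2 (ae_of_all _ fun t ht => Real.rpow_nonneg ht.1.le _))]
  refine ENNReal.ofReal_le_ofReal ?_
  rw [← integral_Ioc_eq_integral_Ioo, ← intervalIntegral.integral_of_le hF,
    integral_rpow (Or.inl hr), Real.zero_rpow (by linarith), sub_zero]

lemma lintegral_indicator_rpow_ge_le {r F : ℝ} (hr : r < -1) (hF : 0 < F) :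
    ∫⁻ t in Set.Ioi (0 : ℝ), (Set.Ici F).indicator (fun t => ENNReal.ofReal (t ^ r)) t
      ≤ ENNReal.ofReal (F ^ (r + 1) / (-(r + 1))) := by
  have hi : IntegrableOn (fun t : ℝ => t ^ r) (Set.Ioi F) volume :=
    integrableOn_Ioi_rpow_of_lt hr hF
  rw [lintegral_indicator measurableSet_Ici, Measure.restrict_restrict measurableSet_Ici,
    Set.inter_eq_left.2 (Set.Ici_subset_Ioi.2 hF), setLIntegral_congr Ioi_ae_eq_Ici.symm,
    ← ofReal_integral_eq_lintegral_ofReal hi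
      ((ae_restrict_iff' measurableSet_Ioi).2
        (ae_of_all _ fun t ht => Real.rpow_nonneg (hF.trans ht).le _))]
  refine ENNReal.ofReal_le_ofReal ?_
  rw [integral_Ioi_rpow_of_lt hr hF, div_neg, neg_div]

lemma lintegral_lintegral_swap_restrict_volume {k : ℝ → UnitAddCircle → ℝ≥0∞}
    (hk : Measurable (Function.uncurry k)) :
    ∫⁻ t in Set.Ioi (0 : ℝ), ∫⁻ x, k t x = ∫⁻ x, ∫⁻ t in Set.Ioi (0 : ℝ), k t x :=
  lintegral_lintegral_swap hk.aemeasurable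

/-- Marcinkiewicz interpolation between weak `(1,1)` and strong `(2,2)`, for a distribution
function dominated by truncations. -/
lemma lintegral_rpow_le_of_distribution_le {F G : UnitAddCircle → ℝ} (hF : Measurable F)
    (hF0 : ∀ x, 0 ≤ F x) (hG : Measurable G) (hG0 : ∀ x, 0 ≤ G x) {U V : ℝ} (hU : 0 ≤ U)
    (hV : 0 ≤ V) {p : ℝ} (hp1 : 1 < p) (hp2 : p < 2)
    (h : ∀ t : ℝ, 0 < t → volume {x | t < G x}
      ≤ ENNReal.ofReal (U / t) * (∫⁻ x, {x | t < F x}.indicator (fun x => ENNReal.ofReal (F x)) x)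
        + ENNReal.ofReal (V / t ^ 2)
          * ∫⁻ x, {x | F x ≤ t}.indicator (fun x => ENNReal.ofReal (F x ^ 2)) x) :
    ∫⁻ x, ENNReal.ofReal (G x ^ p)
      ≤ ENNReal.ofReal (p * (U / (p - 1) + V / (2 - p))) * ∫⁻ x, ENNReal.ofReal (F x ^ p) := by
  have hp0 : 0 < p := by linarith
  -- In the layer cake formula the weight t^(p-1) meets the factors t⁻¹ and t⁻² of the hypothesis.
  -- After Tonelli the t-integrals run over (0, F) and [F, ∞), and converge because p - 2 > -1 and p
  -- - 3 < -1; both are multiples of F^p.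
  set k₁ : ℝ → UnitAddCircle → ℝ≥0∞ := fun t x =>
    ENNReal.ofReal (F x) * (Set.Iio (F x)).indicator (fun t => ENNReal.ofReal (t ^ (p - 2))) t
    with hk₁
  set k₂ : ℝ → UnitAddCircle → ℝ≥0∞ := fun t x =>
    ENNReal.ofReal (F x ^ 2) * (Set.Ici (F x)).indicator (fun t => ENNReal.ofReal (t ^ (p - 3))) t
    with hk₂
  have hm₁ : Measurable (Function.uncurry k₁) := by
    have hs : MeasurableSet {z : ℝ × UnitAddCircle | z.1 < F z.2} :=
      measurableSet_lt measurable_fst (hF.comp measurable_snd)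
    have : Function.uncurry k₁ = fun z => ENNReal.ofReal (F z.2) *
        {z : ℝ × UnitAddCircle | z.1 < F z.2}.indicator
          (fun z => ENNReal.ofReal (z.1 ^ (p - 2))) z := by
      funext z; simp [hk₁, Function.uncurry, Set.indicator]
    rw [this]
    exact (hF.comp measurable_snd).ennreal_ofReal.mul
      (Measurable.indicator (by fun_prop) hs)
  have hm₂ : Measurable (Function.uncurry k₂) := by
    have hs : MeasurableSet {z : ℝ × UnitAddCircle | F z.2 ≤ z.1} :=
      measurableSet_le (hF.comp measurable_snd) measurable_fst
    have : Function.uncurry k₂ = fun z => ENNReal.ofReal (F z.2 ^ 2) *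
        {z : ℝ × UnitAddCircle | F z.2 ≤ z.1}.indicator
          (fun z => ENNReal.ofReal (z.1 ^ (p - 3))) z := by
      funext z; simp [hk₂, Function.uncurry, Set.indicator]
    rw [this]
    exact ((hF.comp measurable_snd).pow_const 2).ennreal_ofReal.mul
      (Measurable.indicator (by fun_prop) hs)
  rw [lintegral_rpow_eq_lintegral_meas_lt_mul volume (ae_of_all _ hG0) hG.aemeasurable hp0]
  have step : ∫⁻ t in Set.Ioi (0 : ℝ), volume {x | t < G x} * ENNReal.ofReal (t ^ (p - 1))
      ≤ ∫⁻ t in Set.Ioi (0 : ℝ), (ENNReal.ofReal U * ∫⁻ x, k₁ t x)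
          + ENNReal.ofReal V * ∫⁻ x, k₂ t x := by
    refine setLIntegral_mono' measurableSet_Ioi fun t ht => ?_
    have ht : 0 < t := ht
    refine (mul_le_mul_left (h t ht) _).trans_eq ?_
    rw [add_mul]
    congr 1
    · rw [← lintegral_const_mul' _ _ ENNReal.ofReal_ne_top,
        ← lintegral_const_mul' _ _ ENNReal.ofReal_ne_top,
        ← lintegral_mul_const' _ _ ENNReal.ofReal_ne_top]
      refine lintegral_congr fun x => ?_
      by_cases hx : t < F x
      · have e : U / t * F x * t ^ (p - 1) = U * (F x * t ^ (p - 2)) := by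
          have : t ^ (p - 1) = t * t ^ (p - 2) := by
            rw [← Real.rpow_one_add' ht.le (by linarith)]; congr 1; ring
          rw [this]; field_simp
        have hx' : t ∈ Set.Iio (F x) := hx
        simp only [hk₁, Set.indicator_of_mem hx']
        simp only [Set.indicator, Set.mem_ofPred_eq, hx, if_true]
        rw [← ENNReal.ofReal_mul (by positivity),
          ← ENNReal.ofReal_mul (mul_nonneg (by positivity) (hF0 x)),
          ← ENNReal.ofReal_mul (hF0 x), ← ENNReal.ofReal_mul hU, e]
      · have hx' : t ∉ Set.Iio (F x) := hx
        simp only [hk₁, Set.indicator_of_notMem hx']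
        simp only [Set.indicator, Set.mem_ofPred_eq, hx, if_false, mul_zero, zero_mul]
    · rw [← lintegral_const_mul' _ _ ENNReal.ofReal_ne_top,
        ← lintegral_const_mul' _ _ ENNReal.ofReal_ne_top,
        ← lintegral_mul_const' _ _ ENNReal.ofReal_ne_top]
      refine lintegral_congr fun x => ?_
      by_cases hx : F x ≤ t
      · have e : V / t ^ 2 * F x ^ 2 * t ^ (p - 1) = V * (F x ^ 2 * t ^ (p - 3)) := by
          have : t ^ (p - 1) = t ^ 2 * t ^ (p - 3) := by
            rw [← Real.rpow_natCast, ← Real.rpow_add ht]; congr 1; push_cast; ring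
          rw [this]; field_simp
        have hx' : t ∈ Set.Ici (F x) := hx
        simp only [hk₂, Set.indicator_of_mem hx']
        simp only [Set.indicator, Set.mem_ofPred_eq, hx, if_true]
        rw [← ENNReal.ofReal_mul (by positivity),
          ← ENNReal.ofReal_mul (by positivity),
          ← ENNReal.ofReal_mul (by positivity), ← ENNReal.ofReal_mul hV, e]
      · have hx' : t ∉ Set.Ici (F x) := hx
        simp only [hk₂, Set.indicator_of_notMem hx']
        simp only [Set.indicator, Set.mem_ofPred_eq, hx, if_false, mul_zero, zero_mul]
  have b₁ : ∫⁻ t in Set.Ioi (0 : ℝ), ∫⁻ x, k₁ t x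
      ≤ ENNReal.ofReal (1 / (p - 1)) * ∫⁻ x, ENNReal.ofReal (F x ^ p) := by
    rw [lintegral_lintegral_swap_restrict_volume hm₁,
      ← lintegral_const_mul' _ _ ENNReal.ofReal_ne_top]
    refine lintegral_mono fun x => ?_
    simp only [hk₁]
    rw [lintegral_const_mul' _ _ ENNReal.ofReal_ne_top]
    refine (mul_le_mul_right (lintegral_indicator_rpow_lt_le (by linarith) (hF0 x)) _).trans_eq ?_
    rw [← ENNReal.ofReal_mul (hF0 x), ← ENNReal.ofReal_mul (by
      have : 0 < p - 1 := by linarith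
      positivity)]
    congr 1
    have e : p - 2 + 1 = p - 1 := by ring
    rw [e]
    have : F x ^ p = F x * F x ^ (p - 1) := by
      rw [← Real.rpow_one_add' (hF0 x) (by linarith)]; congr 1; ring
    rw [this]; ring
  have b₂ : ∫⁻ t in Set.Ioi (0 : ℝ), ∫⁻ x, k₂ t x
      ≤ ENNReal.ofReal (1 / (2 - p)) * ∫⁻ x, ENNReal.ofReal (F x ^ p) := by
    rw [lintegral_lintegral_swap_restrict_volume hm₂,
      ← lintegral_const_mul' _ _ ENNReal.ofReal_ne_top]
    refine lintegral_mono fun x => ?_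
    simp only [hk₂]
    rw [lintegral_const_mul' _ _ ENNReal.ofReal_ne_top]
    -- At F x = 0 the integral of t^(p-3) down to 0 diverges; the factor F² = 0 in front removes it.
    rcases (hF0 x).eq_or_lt with h0 | h0
    · rw [← h0]; simp
    · refine (mul_le_mul_right (lintegral_indicator_rpow_ge_le (by linarith) h0) _).trans_eq ?_
      rw [← ENNReal.ofReal_mul (by positivity), ← ENNReal.ofReal_mul (by
        have : 0 < 2 - p := by linarith
        positivity)]
      congr 1
      have e : p - 3 + 1 = p - 2 := by ring
      rw [e]
      have : F x ^ p = F x ^ 2 * F x ^ (p - 2) := by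
        rw [← Real.rpow_natCast, ← Real.rpow_add h0]; congr 1; push_cast; ring
      rw [this, neg_sub]; ring
  have hpm : 0 < p - 1 := by linarith
  have hpm2 : 0 < 2 - p := by linarith
  have hm₁i : Measurable fun t => ∫⁻ x, k₁ t x := Measurable.lintegral_prod_right' hm₁
  calc ENNReal.ofReal p
        * ∫⁻ t in Set.Ioi (0 : ℝ), volume {x | t < G x} * ENNReal.ofReal (t ^ (p - 1))
      ≤ ENNReal.ofReal p * (ENNReal.ofReal U * (ENNReal.ofReal (1 / (p - 1))
            * ∫⁻ x, ENNReal.ofReal (F x ^ p))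
          + ENNReal.ofReal V * (ENNReal.ofReal (1 / (2 - p))
            * ∫⁻ x, ENNReal.ofReal (F x ^ p))) := by
        gcongr
        refine step.trans ?_
        rw [lintegral_add_left (hm₁i.const_mul _), lintegral_const_mul' _ _ ENNReal.ofReal_ne_top,
          lintegral_const_mul' _ _ ENNReal.ofReal_ne_top]
        gcongr
    _ = _ := by
        rw [← mul_assoc (ENNReal.ofReal U), ← mul_assoc (ENNReal.ofReal V), ← add_mul, ← mul_assoc,
          ← ENNReal.ofReal_mul hU, ← ENNReal.ofReal_mul hV,
          ← ENNReal.ofReal_add (by positivity) (by positivity), ← ENNReal.ofReal_mul hp0.le]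
        congr 3; ring

lemma fourierMultiplier_congr_ae (S : Finset ℤ) (a : ℤ → ℂ) {f g : UnitAddCircle → ℂ}
    (h : f =ᵐ[volume] g) : fourierMultiplier S a f = fourierMultiplier S a g := by
  rw [← haarAddCircle_eq_volume] at h
  simp only [fourierMultiplier, fourierCoeff_congr_ae h]

lemma lintegral_enorm_rpow_eq_ofReal (f : UnitAddCircle → ℂ) {p : ℝ} (hp : 0 ≤ p) :
    ∫⁻ x, ‖f x‖ₑ ^ p = ∫⁻ x, ENNReal.ofReal (‖f x‖ ^ p) :=
  lintegral_congr fun x => by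
    rw [← ofReal_norm, ENNReal.ofReal_rpow_of_nonneg (norm_nonneg _) hp]

section interpolation

variable {S : Finset ℤ} {a : ℤ → ℂ} {A W : ℝ}

/-- At each height t, cut f at |f| = t: the large part is integrable and goes through the weak type
hypothesis, the small part is bounded and goes through L² Chebyshev. Each is tested at level t/2,
hence the 2W and 4A². -/
lemma lintegral_fourierMultiplier_rpow_le (ha : ∀ t, ‖a t‖ ≤ A) (hW0 : 0 ≤ W)
    (hW : ∀ f : UnitAddCircle → ℂ, Integrable f volume → ∀ s : ℝ, 0 < s →
      s * volume.real {x | s < ‖fourierMultiplier S a f x‖} ≤ W * ∫ x, ‖f x‖)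
    {p : ℝ} (hp1 : 1 < p) (hp2 : p < 2) {f : UnitAddCircle → ℂ} (hf : Integrable f volume) :
    ∫⁻ x, ‖fourierMultiplier S a f x‖ₑ ^ p
      ≤ ENNReal.ofReal (p * (2 * W / (p - 1) + 4 * A ^ 2 / (2 - p))) * ∫⁻ x, ‖f x‖ₑ ^ p := by
  -- The operator sees f only through its Fourier coefficients, so a measurable representative may
  -- be used.
  wlog hfm : Measurable f generalizing f
  · have h := this (f := hf.1.mk f) (hf.congr hf.1.ae_eq_mk) hf.1.stronglyMeasurable_mk.measurable
    rw [← fourierMultiplier_congr_ae S a hf.1.ae_eq_mk] at h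
    refine h.trans_eq ?_
    congr 1
    refine lintegral_congr_ae ?_
    filter_upwards [hf.1.ae_eq_mk] with x hx
    rw [hx]
  have hp0 : 0 ≤ p := by linarith
  rw [lintegral_enorm_rpow_eq_ofReal _ hp0, lintegral_enorm_rpow_eq_ofReal _ hp0]
  refine lintegral_rpow_le_of_distribution_le hfm.norm (fun x => norm_nonneg _)
    (continuous_fourierMultiplier S a f).norm.measurable (fun x => norm_nonneg _)
    (by positivity) (by positivity) hp1 hp2 fun t ht => ?_
  set B := {x | t < ‖f x‖} with hB
  have hBm : MeasurableSet B := measurableSet_lt measurable_const hfm.norm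
  have hBc : {x | ‖f x‖ ≤ t} = Bᶜ := by ext x; simp [hB]
  have hf1 : Integrable (B.indicator f) volume := hf.indicator hBm
  have hf2m : MemLp (Bᶜ.indicator f) 2 volume := by
    refine MemLp.of_bound (hf.indicator hBm.compl).1 t (ae_of_all _ fun x => ?_)
    by_cases hx : x ∈ Bᶜ
    · rw [Set.indicator_of_mem hx, ← not_lt]; exact hx
    · rw [Set.indicator_of_notMem hx, norm_zero]; exact ht.le
  have hf2 : Integrable (Bᶜ.indicator f) volume := hf2m.integrable one_le_two
  have hsplit : f = B.indicator f + Bᶜ.indicator f := (Set.indicator_self_add_compl B f).symm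
  set T₁ := fourierMultiplier S a (B.indicator f)
  set T₂ := fourierMultiplier S a (Bᶜ.indicator f)
  have hincl : {x | t < ‖fourierMultiplier S a f x‖}
      ⊆ {x | t / 2 < ‖T₁ x‖} ∪ {x | (t / 2) ^ 2 ≤ ‖T₂ x‖ ^ 2} := by
    intro x hx
    by_contra hcon
    simp only [Set.mem_union, Set.mem_ofPred_eq, not_or, not_lt, not_le] at hcon
    have h2 : ‖T₂ x‖ < t / 2 := lt_of_pow_lt_pow_left₀ 2 (by positivity) hcon.2
    have hx : t < ‖fourierMultiplier S a f x‖ := hx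
    rw [hsplit, fourierMultiplier_add S a hf1 hf2] at hx
    linarith [norm_add_le (T₁ x) (T₂ x), hcon.1]
  have m1 : volume.real {x | t / 2 < ‖T₁ x‖} ≤ 2 * W / t * ∫ x, ‖B.indicator f x‖ := by
    have := hW _ hf1 (t / 2) (by positivity)
    rw [div_mul_eq_mul_div, le_div_iff₀ ht]
    linarith
  have m2 : volume.real {x | (t / 2) ^ 2 ≤ ‖T₂ x‖ ^ 2}
      ≤ 4 * A ^ 2 / t ^ 2 * ∫ x, ‖Bᶜ.indicator f x‖ ^ 2 := by
    have h1 := (mul_meas_ge_le_integral_of_nonneg (ae_of_all _ fun x => sq_nonneg _)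
      ((continuous_fourierMultiplier S a (Bᶜ.indicator f)).norm.pow 2).integrable_unitAddCircle
      ((t / 2) ^ 2)).trans (integral_norm_sq_fourierMultiplier_le ha hf2m)
    rw [div_mul_eq_mul_div, le_div_iff₀ (by positivity)]
    linarith
  have i1 : ENNReal.ofReal (∫ x, ‖B.indicator f x‖)
      = ∫⁻ x, B.indicator (fun x => ENNReal.ofReal ‖f x‖) x := by
    rw [ofReal_integral_eq_lintegral_ofReal hf1.norm (ae_of_all _ fun x => norm_nonneg _)]
    refine lintegral_congr fun x => ?_
    by_cases hx : x ∈ B <;> simp [hx]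
  have i2 : ENNReal.ofReal (∫ x, ‖Bᶜ.indicator f x‖ ^ 2)
      = ∫⁻ x, {x | ‖f x‖ ≤ t}.indicator (fun x => ENNReal.ofReal (‖f x‖ ^ 2)) x := by
    rw [ofReal_integral_eq_lintegral_ofReal ((memLp_two_iff_integrable_sq_norm hf2m.1).1 hf2m)
      (ae_of_all _ fun x => sq_nonneg _), hBc]
    refine lintegral_congr fun x => ?_
    by_cases hx : x ∈ Bᶜ
    · rw [Set.indicator_of_mem hx, Set.indicator_of_mem hx]
    · rw [Set.indicator_of_notMem hx, Set.indicator_of_notMem hx]; simp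
  rw [← i1, ← i2, ← ENNReal.ofReal_mul (by positivity), ← ENNReal.ofReal_mul (by positivity)]
  refine (measure_mono hincl).trans ((measure_union_le _ _).trans ?_)
  refine add_le_add ?_ ?_
  · rw [← ofReal_measureReal]; exact ENNReal.ofReal_le_ofReal m1
  · rw [← ofReal_measureReal]; exact ENNReal.ofReal_le_ofReal m2

/-! ### Duality and uniform L^p bounds for all 1 < p < ∞. -/

lemma eLpNorm_le_of_lintegral_rpow_le {f g : UnitAddCircle → ℂ} {p : ℝ} (hp : 0 < p) {K : ℝ≥0}
    (h : ∫⁻ x, ‖g x‖ₑ ^ p ≤ K * ∫⁻ x, ‖f x‖ₑ ^ p) :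
    eLpNorm g (ENNReal.ofReal p) volume
      ≤ (K ^ (1 / p) : ℝ≥0) * eLpNorm f (ENNReal.ofReal p) volume := by
  rw [eLpNorm_eq_lintegral_rpow_enorm_toReal (by simpa using hp) ENNReal.ofReal_ne_top,
    eLpNorm_eq_lintegral_rpow_enorm_toReal (by simpa using hp) ENNReal.ofReal_ne_top,
    ENNReal.toReal_ofReal hp.le, ENNReal.coe_rpow_of_nonneg _ (by positivity),
    ← ENNReal.mul_rpow_of_nonneg _ _ (by positivity)]
  gcongr

/-- The adjoint is the multiplier with conjugate coefficients, which obey the same discrete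
condition. -/
lemma integral_conj_fourierMultiplier_mul {f g : UnitAddCircle → ℂ} (hf : Integrable f volume)
    (hg : Integrable g volume) :
    ∫ x, conj (fourierMultiplier S a f x) * g x
      = conj (∫ x, conj (fourierMultiplier S (fun t => conj (a t)) g x) * f x) := by
  rw [fourierMultiplier, fourierMultiplier, integral_conj_trigPoly_mul _ _ hf,
    integral_conj_trigPoly_mul _ _ hg, map_sum]
  refine Finset.sum_congr rfl fun t _ => ?_
  simp only [map_mul, Complex.conj_conj]; ring

/-- Boundedness on `L^q` of the adjoint multiplier gives boundedness on `L^p`. -/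
lemma eLpNorm_fourierMultiplier_le_of_dual {p q : ℝ} (hpq : p.HolderConjugate q) {K : ℝ≥0}
    (hK : ∀ g : UnitAddCircle → ℂ, Continuous g →
      eLpNorm (fourierMultiplier S (fun t => conj (a t)) g) (ENNReal.ofReal q) volume
        ≤ K * eLpNorm g (ENNReal.ofReal q) volume)
    {f : UnitAddCircle → ℂ} (hf : Integrable f volume) (hp1 : 1 < p) :
    eLpNorm (fourierMultiplier S a f) (ENNReal.ofReal p) volume
      ≤ K * eLpNorm f (ENNReal.ofReal p) volume := by
  have hp0 : 0 < p := hpq.pos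
  have hq0 : 0 < q := hpq.symm.pos
  set T := fourierMultiplier S a f with hT
  have hTc : Continuous T := continuous_fourierMultiplier S a f
  -- The extremal dual function: conj(T)g and |g|^q both equal |T|^p. It is continuous even at zeros
  -- of T, because |g| = |T|^(p-1) and p > 1.
  set g : UnitAddCircle → ℂ := fun x => ((‖T x‖ ^ (p - 2) : ℝ) : ℂ) * T x with hg
  have hgn : ∀ x, ‖g x‖ = ‖T x‖ ^ (p - 1) := by
    intro x
    simp only [hg, norm_mul, Complex.norm_real, Real.norm_of_nonneg (Real.rpow_nonneg
      (norm_nonneg (T x)) (p - 2))]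
    rcases eq_or_ne (T x) 0 with h | h
    · rw [h, norm_zero, mul_zero, Real.zero_rpow (by linarith)]
    · rw [← Real.rpow_add_one (norm_ne_zero_iff.2 h)]; congr 1; ring
  have hgc : Continuous g := by
    rw [continuous_iff_continuousAt]
    intro x
    rcases eq_or_ne (T x) 0 with h | h
    · have hgx : g x = 0 := by simp only [hg, h, mul_zero]
      rw [ContinuousAt, hgx, tendsto_zero_iff_norm_tendsto_zero]
      simp_rw [hgn]
      have : Continuous fun x => ‖T x‖ ^ (p - 1) :=
        hTc.norm.rpow_const fun _ => Or.inr (by linarith)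
      have h2 := this.tendsto x
      rwa [h, norm_zero, Real.zero_rpow (by linarith)] at h2
    · exact (Complex.continuous_ofReal.continuousAt.comp
        (hTc.norm.continuousAt.rpow_const (Or.inl (norm_ne_zero_iff.2 h)))).mul hTc.continuousAt
  have hconj : ∀ x, conj (T x) * g x = ((‖T x‖ ^ p : ℝ) : ℂ) := by
    intro x
    have e : conj (T x) * g x = ((‖T x‖ ^ (p - 2) * ‖T x‖ ^ 2 : ℝ) : ℂ) := by
      simp only [hg]
      push_cast
      rw [← Complex.conj_mul']; ring
    rw [e]
    congr 1
    rcases eq_or_ne (T x) 0 with h | h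
    · rw [h, norm_zero, Real.zero_rpow hp0.ne']; norm_num
    · rw [← Real.rpow_natCast, ← Real.rpow_add (norm_pos_iff.2 h)]; congr 1; push_cast; ring
  have hTpc : Continuous fun x => ‖T x‖ ^ p := hTc.norm.rpow_const fun _ => Or.inr hp0.le
  set X := ∫⁻ x, ‖T x‖ₑ ^ p with hX
  have hXeq : X = ENNReal.ofReal (∫ x, ‖T x‖ ^ p) := by
    rw [hX, lintegral_enorm_rpow_eq_ofReal _ hp0.le, ofReal_integral_eq_lintegral_ofReal
      hTpc.integrable_unitAddCircle (ae_of_all _ fun x => by positivity)]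
  have hXtop : X ≠ ⊤ := by rw [hXeq]; exact ENNReal.ofReal_ne_top
  have hgX : ∫⁻ x, ‖g x‖ₑ ^ q = X := by
    refine lintegral_congr fun x => ?_
    rw [← ofReal_norm, hgn, ENNReal.ofReal_rpow_of_nonneg (by positivity) hq0.le,
      ← Real.rpow_mul (norm_nonneg _), hpq.sub_one_mul_conj, ← ofReal_norm,
      ENNReal.ofReal_rpow_of_nonneg (norm_nonneg _) hp0.le]
  have hnorm : ∀ (u : UnitAddCircle → ℂ) {r : ℝ}, 0 < r →
      eLpNorm u (ENNReal.ofReal r) volume = (∫⁻ x, ‖u x‖ₑ ^ r) ^ (1 / r) := by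
    intro u r hr
    rw [eLpNorm_eq_lintegral_rpow_enorm_toReal (by simpa using hr) ENNReal.ofReal_ne_top,
      ENNReal.toReal_ofReal hr.le]
  set T' := fourierMultiplier S (fun t => conj (a t)) g with hT'
  have hT'c : Continuous T' := continuous_fourierMultiplier _ _ _
  have main : X ≤ K * X ^ (1 / q) * eLpNorm f (ENNReal.ofReal p) volume := by
    calc X = ‖∫ x, conj (T x) * g x‖ₑ := by
          simp_rw [hconj]
          rw [integral_complex_ofReal, hXeq, ← ofReal_norm, Complex.norm_real,
            Real.norm_of_nonneg (integral_nonneg fun x => by positivity)]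
      _ = ‖∫ x, conj (T' x) * f x‖ₑ := by
          rw [hT, integral_conj_fourierMultiplier_mul hf hgc.integrable_unitAddCircle,
            RCLike.enorm_conj]
      _ ≤ ∫⁻ x, ‖conj (T' x) * f x‖ₑ := enorm_integral_le_lintegral_enorm _
      _ = ∫⁻ x, ((fun x => ‖T' x‖ₑ) * fun x => ‖f x‖ₑ) x :=
          lintegral_congr fun x => by simp [enorm_mul]
      _ ≤ (∫⁻ x, ‖T' x‖ₑ ^ q) ^ (1 / q) * (∫⁻ x, ‖f x‖ₑ ^ p) ^ (1 / p) :=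
          ENNReal.lintegral_mul_le_Lp_mul_Lq volume hpq.symm
            hT'c.measurable.enorm.aemeasurable hf.1.enorm
      _ ≤ _ := by
          rw [← hnorm f hp0, ← hnorm T' hq0, ← hgX, ← hnorm g hq0]
          gcongr
          exact hK g hgc
  rw [hnorm T hp0, ← hX]
  rcases eq_or_ne X 0 with h0 | h0
  · rw [h0, ENNReal.zero_rpow_of_pos (by positivity)]; exact zero_le
  · have hXq0 : X ^ (1 / q) ≠ 0 := by
      rw [Ne, ENNReal.rpow_eq_zero_iff]; simp [h0, hXtop]
    have hXqt : X ^ (1 / q) ≠ ⊤ := ENNReal.rpow_ne_top_of_nonneg (by positivity) hXtop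
    have e : X = X ^ (1 / q) * X ^ (1 / p) := by
      rw [← ENNReal.rpow_add _ _ h0 hXtop]
      have : 1 / q + 1 / p = 1 := by
        rw [one_div, one_div]; exact hpq.symm.inv_add_inv_eq_one
      rw [this, ENNReal.rpow_one]
    -- Hölder gave X ≤ K X^(1/q) ‖f‖_p. Dividing by X^(1/q) is allowed because X is finite, T being
    -- continuous on a compact space.
    rw [← ENNReal.mul_le_mul_iff_right hXq0 hXqt]
    calc X ^ (1 / q) * X ^ (1 / p) = X := e.symm
      _ ≤ _ := main
      _ = _ := by ring

lemma eLpNorm_two_fourierMultiplier_le (hA : 0 ≤ A) (ha : ∀ t, ‖a t‖ ≤ A) {f : UnitAddCircle → ℂ}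
    (hf : MemLp f 2 volume) :
    eLpNorm (fourierMultiplier S a f) 2 volume ≤ ENNReal.ofReal A * eLpNorm f 2 volume := by
  have hT : MemLp (fourierMultiplier S a f) 2 volume :=
    (continuous_fourierMultiplier S a f).memLp_of_hasCompactSupport
      (HasCompactSupport.of_compactSpace _)
  rw [hT.eLpNorm_eq_integral_rpow_norm (by norm_num) (by norm_num),
    hf.eLpNorm_eq_integral_rpow_norm (by norm_num) (by norm_num), ← ENNReal.ofReal_mul hA]
  refine ENNReal.ofReal_le_ofReal ?_
  simp only [ENNReal.toReal_ofNat, Real.rpow_two]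
  have h := integral_norm_sq_fourierMultiplier_le (S := S) ha hf
  calc (∫ x, ‖fourierMultiplier S a f x‖ ^ 2) ^ (2 : ℝ)⁻¹
      ≤ (A ^ 2 * ∫ x, ‖f x‖ ^ 2) ^ (2 : ℝ)⁻¹ := by
        gcongr
    _ = _ := by
        rw [Real.mul_rpow (by positivity) (by positivity), ← Real.rpow_natCast, ← Real.rpow_mul hA]
        norm_num

end interpolation

/-- Boundedness on `L^p` of symmetric partial sums, uniformly in their order. -/
theorem IsDiscreteMarcinkiewicz.exists_eLpNorm_partialSum_le {A : ℝ} (hA : 0 < A) {a : ℤ → ℂ}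
    (ha : IsDiscreteMarcinkiewicz A a) {p : ℝ} (hp : 1 < p) :
    ∃ C : ℝ≥0, ∀ N : ℕ, 1 ≤ N → ∀ f : UnitAddCircle → ℂ, MemLp f (ENNReal.ofReal p) volume →
      eLpNorm (fourierMultiplier (Finset.Icc (-(N : ℤ)) N) a f) (ENNReal.ofReal p) volume
        ≤ C * eLpNorm f (ENNReal.ofReal p) volume := by
  have hW0 : 0 ≤ 9 * weakTypeConst (2 * A) := by unfold weakTypeConst; positivity
  have low : ∀ b : ℤ → ℂ, IsDiscreteMarcinkiewicz A b → ∀ r : ℝ, 1 < r → r < 2 →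
      ∃ C : ℝ≥0, ∀ N : ℕ, 1 ≤ N → ∀ f : UnitAddCircle → ℂ, Integrable f volume →
        eLpNorm (fourierMultiplier (Finset.Icc (-(N : ℤ)) N) b f) (ENNReal.ofReal r) volume
          ≤ C * eLpNorm f (ENNReal.ofReal r) volume := by
    intro b hb r hr1 hr2
    exact ⟨_, fun N hN f hf => eLpNorm_le_of_lintegral_rpow_le (by linarith)
      (lintegral_fourierMultiplier_rpow_le hb.bound hW0
        (fun f hf s hs => hb.weak_type_partialSum hA hN hf hs) hr1 hr2 hf)⟩
  have hint : ∀ f : UnitAddCircle → ℂ, MemLp f (ENNReal.ofReal p) volume → Integrable f volume :=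
    fun f hf => hf.integrable (by simpa using hp.le)
  rcases lt_trichotomy p 2 with h | h | h
  · obtain ⟨C, hC⟩ := low a ha p hp h
    exact ⟨C, fun N hN f hf => hC N hN f (hint f hf)⟩
  · subst h
    refine ⟨A.toNNReal, fun N _ f hf => ?_⟩
    have e : ENNReal.ofReal 2 = 2 := by norm_num
    rw [e] at hf ⊢
    exact eLpNorm_two_fourierMultiplier_le hA.le ha.bound hf
  -- For p > 2 the conjugate exponent lies in (1, 2), where interpolation applies to the conjugate
  -- coefficients.
  · have hpq := Real.HolderConjugate.conjExponent hp
    obtain ⟨C, hC⟩ := low _ ha.conj p.conjExponent hpq.symm.lt (by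
      rw [Real.conjExponent, div_lt_iff₀ (by linarith)]; linarith)
    exact ⟨C, fun N hN f hf => eLpNorm_fourierMultiplier_le_of_dual hpq
      (fun g hg => hC N hN g hg.integrable_unitAddCircle) (hint f hf) hp⟩

/-! ### Convergence in measure of the partial sums. -/

lemma exists_trigPoly_integral_norm_sub_le {f : UnitAddCircle → ℂ} (hf : Integrable f volume)
    {ε : ℝ} (hε : 0 < ε) : ∃ (S : Finset ℤ) (b : ℤ → ℂ), ∫ x, ‖f x - trigPoly S b x‖ ≤ ε := by
  rw [← haarAddCircle_eq_volume] at hf ⊢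
  have hcl : hf.toL1 f ∈ (Submodule.span ℂ (Set.range (@fourierLp 1 _ 1 _))).topologicalClosure := by
    rw [span_fourierLp_closure_eq_top ENNReal.one_ne_top]; trivial
  obtain ⟨P, hP, hd⟩ := Metric.mem_closure_iff.1 hcl ε hε
  obtain ⟨c, rfl⟩ := Finsupp.mem_span_range_iff_exists_finsupp.1 hP
  refine ⟨c.support, c, ?_⟩
  have hae : ((c.sum fun i a => a • (@fourierLp 1 _ 1 _ i) :
      Lp ℂ 1 (AddCircle.haarAddCircle : Measure UnitAddCircle)) : UnitAddCircle → ℂ)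
      =ᵐ[AddCircle.haarAddCircle] trigPoly c.support c := by
    have h1 : ∀ᵐ x ∂(AddCircle.haarAddCircle : Measure UnitAddCircle), ∀ i ∈ c.support,
        (c i • (@fourierLp 1 _ 1 _ i) : Lp ℂ 1 AddCircle.haarAddCircle) x
          = c i * fourier i x := by
      refine (ae_ball_iff c.support.countable_toSet).2 fun i _ => ?_
      filter_upwards [Lp.coeFn_smul (c i) (@fourierLp 1 _ 1 _ i),
        coeFn_fourierLp (T := 1) 1 i] with x h1 h2
      rw [h1, Pi.smul_apply, h2, smul_eq_mul]
    filter_upwards [Lp.coeFn_finsetSum c.support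
      (fun i => (c i • (@fourierLp 1 _ 1 _ i) : Lp ℂ 1 AddCircle.haarAddCircle)), h1] with x hx h1
    rw [Finsupp.sum, hx, Finset.sum_apply, trigPoly]
    exact Finset.sum_congr rfl h1
  rw [dist_eq_norm, L1.norm_eq_integral_norm] at hd
  refine le_of_eq_of_le (integral_congr_ae ?_) hd.le
  filter_upwards [Lp.coeFn_sub (hf.toL1 f) (c.sum fun i a => a • (@fourierLp 1 _ 1 _ i)),
    hae, hf.coeFn_toL1] with x h1 h2 h3
  rw [h1, Pi.sub_apply, h2, h3]

/-- A sequence that is Cauchy in measure converges in measure. -/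
lemma exists_tendstoInMeasure_of_cauchy {Ω : Type*} [MeasurableSpace Ω] {μ : Measure Ω}
    [IsFiniteMeasure μ] {u : ℕ → Ω → ℂ} (hu : ∀ n, StronglyMeasurable (u n))
    (hc : ∀ ε : ℝ, 0 < ε → ∃ N₀, ∀ N ≥ N₀, ∀ M ≥ N₀, μ.real {x | ε < ‖u N x - u M x‖} ≤ ε) :
    ∃ g, AEStronglyMeasurable g μ ∧ TendstoInMeasure μ u atTop g := by
  have hpos : ∀ k : ℕ, (0 : ℝ) < (1 / 2) ^ k := fun k => by positivity
  choose n₀ hn₀ using fun k : ℕ => hc ((1 / 2) ^ k) (hpos k)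
  -- The sum dominates every threshold n₀ j with j ≤ k; the added k makes the indices tend to
  -- infinity.
  set n : ℕ → ℕ := fun k => k + ∑ j ∈ Finset.range (k + 1), n₀ j with hn
  have hn_ge : ∀ k, ∀ j ≤ k, n₀ j ≤ n k := fun k j hj =>
    (Finset.single_le_sum (f := n₀) (fun _ _ => Nat.zero_le _)
      (Finset.mem_range.2 (by omega))).trans (Nat.le_add_left _ _)
  set bad : ℕ → Set Ω := fun k => {x | (1 / 2 : ℝ) ^ k < ‖u (n k) x - u (n (k + 1)) x‖} with hbad
  have hbad_le : ∀ k, μ (bad k) ≤ ENNReal.ofReal ((1 / 2) ^ k) := fun k => by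
    rw [← ofReal_measureReal]
    exact ENNReal.ofReal_le_ofReal (hn₀ k _ (hn_ge k k le_rfl) _ (hn_ge (k + 1) k (by omega)))
  have hsum : ∑' k, μ (bad k) ≠ ⊤ := by
    refine ne_top_of_le_ne_top ?_ (ENNReal.tsum_le_tsum hbad_le)
    rw [← ENNReal.ofReal_tsum_of_nonneg (fun k => (hpos k).le) summable_geometric_two]
    exact ENNReal.ofReal_ne_top
  have hlim : ∀ᵐ x ∂μ, ∃ l, Tendsto (fun k => u (n k) x) atTop (𝓝 l) := by
    -- Borel–Cantelli: almost every point eventually leaves the bad sets, and from then on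
    -- consecutive terms differ by at most 2^(-k).
    filter_upwards [ae_eventually_notMem hsum] with x hx
    obtain ⟨K, hK⟩ := eventually_atTop.1 hx
    have hcau : CauchySeq fun k => u (n (k + K)) x := by
      refine cauchySeq_of_le_geometric (1 / 2) 1 (by norm_num) fun k => ?_
      have := hK (k + K) (by omega)
      simp only [hbad, Set.mem_ofPred_eq, not_lt] at this
      rw [dist_eq_norm, one_mul]
      have e : k + 1 + K = k + K + 1 := by omega
      rw [e]
      exact this.trans (pow_le_pow_of_le_one (by norm_num) (by norm_num) (by omega))
    obtain ⟨l, hl⟩ := cauchySeq_tendsto_of_complete hcau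
    exact ⟨l, (tendsto_add_atTop_iff_nat (f := fun k => u (n k) x) K).1 hl⟩
  obtain ⟨g, hgm, hg⟩ := exists_stronglyMeasurable_limit_of_tendsto_ae
    (fun k => (hu (n k)).aestronglyMeasurable) hlim
  have hsub : TendstoInMeasure μ (fun k => u (n k)) atTop g :=
    tendstoInMeasure_of_tendsto_ae (fun k => (hu (n k)).aestronglyMeasurable) hg
  refine ⟨g, hgm.aestronglyMeasurable, ?_⟩
  rw [tendstoInMeasure_iff_measureReal_norm] at hsub ⊢
  intro ε hε
  rw [Metric.tendsto_atTop]
  intro δ hδ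
  set η := min (ε / 4) (δ / 2) with hη
  have hη0 : 0 < η := by positivity
  obtain ⟨N₀, hN₀⟩ := hc η hη0
  obtain ⟨k, hk1, hk2⟩ : ∃ k, N₀ ≤ k ∧ μ.real {x | ε / 2 ≤ ‖u (n k) x - g x‖} < δ / 2 := by
    have h1 := (hsub (ε / 2) (by positivity)).eventually (gt_mem_nhds (half_pos hδ))
    obtain ⟨k, hk⟩ := (h1.and (eventually_ge_atTop N₀)).exists
    exact ⟨k, hk.2, hk.1⟩
  refine ⟨N₀, fun N hN => ?_⟩
  have hnk : N₀ ≤ n k := hk1.trans (Nat.le_add_right _ _)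
  have hincl : {x | ε ≤ ‖u N x - g x‖}
      ⊆ {x | η < ‖u N x - u (n k) x‖} ∪ {x | ε / 2 ≤ ‖u (n k) x - g x‖} := by
    intro x hx
    by_contra hcon
    simp only [Set.mem_union, Set.mem_ofPred_eq, not_or, not_lt, not_le] at hcon
    have hx : ε ≤ ‖u N x - g x‖ := hx
    have := norm_sub_le_norm_sub_add_norm_sub (u N x) (u (n k) x) (g x)
    have := min_le_left (ε / 4) (δ / 2)
    linarith [hcon.1, hcon.2]
  rw [Real.dist_eq, sub_zero, abs_of_nonneg measureReal_nonneg]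
  calc μ.real {x | ε ≤ ‖u N x - g x‖}
      ≤ μ.real {x | η < ‖u N x - u (n k) x‖} + μ.real {x | ε / 2 ≤ ‖u (n k) x - g x‖} :=
        (measureReal_mono hincl).trans (measureReal_union_le _ _)
    _ < δ / 2 + δ / 2 := by
        refine add_lt_add_of_le_of_lt ((hN₀ N hN _ hnk).trans (min_le_right _ _)) hk2
    _ = δ := by ring

/-- Supplies convergence on the dense class: once N passes every frequency, the partial sums no
longer change. -/
lemma exists_fourierMultiplier_trigPoly_eq (a : ℤ → ℂ) (S : Finset ℤ) (b : ℤ → ℂ) :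
    ∃ N₀ : ℕ, ∀ N ≥ N₀, fourierMultiplier (Finset.Icc (-(N : ℤ)) N) a (trigPoly S b)
      = fourierMultiplier S a (trigPoly S b) := by
  refine ⟨S.sup Int.natAbs, fun N hN => ?_⟩
  have h0 : ∀ t ∉ S, a t * fourierCoeff (trigPoly S b) t = 0 := fun t ht => by
    rw [fourierCoeff_trigPoly, if_neg ht, mul_zero]
  refine trigPoly_congr_support (fun t ht => h0 t fun h => ht ?_) h0
  have : t.natAbs ≤ N := (Finset.le_sup (f := Int.natAbs) h).trans hN
  rw [Finset.mem_Icc]; omega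

/-- Write f as a trigonometric polynomial plus an L¹-small remainder. For large N and M the
polynomial cancels from the difference of partial sums, and the uniform weak type bound controls the
remainder. -/
lemma IsDiscreteMarcinkiewicz.exists_tendstoInMeasure_partialSum {A : ℝ} (hA : 0 < A) {a : ℤ → ℂ}
    (ha : IsDiscreteMarcinkiewicz A a) {f : UnitAddCircle → ℂ} (hf : Integrable f volume) :
    ∃ g, AEStronglyMeasurable g volume ∧ TendstoInMeasure volume
      (fun N : ℕ => fourierMultiplier (Finset.Icc (-(N : ℤ)) N) a f) atTop g := by
  refine exists_tendstoInMeasure_of_cauchy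
    (fun N => (continuous_fourierMultiplier _ a f).stronglyMeasurable) fun ε hε => ?_
  set W := 9 * weakTypeConst (2 * A) with hW
  have hW0 : 0 < W := by rw [hW, weakTypeConst]; positivity
  -- With this tolerance the weak type bound at level ε/2 gives measure at most (ε²/4)/(ε/2) = ε/2.
  obtain ⟨S, b, hb⟩ := exists_trigPoly_integral_norm_sub_le hf (ε := ε ^ 2 / (4 * W)) (by positivity)
  obtain ⟨N₀, hN₀⟩ := exists_fourierMultiplier_trigPoly_eq a S b
  set r : UnitAddCircle → ℂ := fun x => f x - trigPoly S b x with hr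
  have hPi : Integrable (trigPoly S b) volume := (continuous_trigPoly S b).integrable_unitAddCircle
  have hri : Integrable r volume := hf.sub hPi
  have hfr : f = r + trigPoly S b := by funext x; simp [hr]
  have hw : ∀ N ≥ N₀ + 1, volume.real
      {x | ε / 2 < ‖fourierMultiplier (Finset.Icc (-(N : ℤ)) N) a r x‖} ≤ ε / 2 := by
    intro N hN
    have h1 := ha.weak_type_partialSum hA (by omega : 1 ≤ N) hri (half_pos hε)
    have h2 : W * ∫ x, ‖r x‖ ≤ ε / 2 * (ε / 2) := by
      calc W * ∫ x, ‖r x‖ ≤ W * (ε ^ 2 / (4 * W)) := by gcongr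
        _ = _ := by field_simp; norm_num
    exact le_of_mul_le_mul_left (h1.trans h2) (half_pos hε)
  refine ⟨N₀ + 1, fun N hN M hM => ?_⟩
  have hincl : {x | ε < ‖fourierMultiplier (Finset.Icc (-(N : ℤ)) N) a f x
        - fourierMultiplier (Finset.Icc (-(M : ℤ)) M) a f x‖}
      ⊆ {x | ε / 2 < ‖fourierMultiplier (Finset.Icc (-(N : ℤ)) N) a r x‖}
        ∪ {x | ε / 2 < ‖fourierMultiplier (Finset.Icc (-(M : ℤ)) M) a r x‖} := by
    intro x hx
    by_contra hcon
    simp only [Set.mem_union, Set.mem_ofPred_eq, not_or, not_lt] at hcon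
    rw [Set.mem_ofPred_eq, hfr, fourierMultiplier_add _ a hri hPi,
      fourierMultiplier_add _ a hri hPi, hN₀ N (by omega), hN₀ M (by omega),
      add_sub_add_right_eq_sub] at hx
    linarith [norm_sub_le (fourierMultiplier (Finset.Icc (-(N : ℤ)) N) a r x)
      (fourierMultiplier (Finset.Icc (-(M : ℤ)) M) a r x), hcon.1, hcon.2]
  refine (measureReal_mono hincl).trans ((measureReal_union_le _ _).trans ?_)
  linarith [hw N hN, hw M hM]

/-- Weak type bounds pass to limits in measure. -/
lemma mul_measureReal_lt_norm_le_of_tendstoInMeasure {Ω : Type*} [MeasurableSpace Ω]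
    {μ : Measure Ω} [IsFiniteMeasure μ] {u : ℕ → Ω → ℂ} {g : Ω → ℂ} {K : ℝ}
    (hu : ∀ᶠ N in atTop, ∀ s : ℝ, 0 < s → s * μ.real {x | s < ‖u N x‖} ≤ K)
    (hg : TendstoInMeasure μ u atTop g) {s : ℝ} (hs : 0 < s) :
    s * μ.real {x | s < ‖g x‖} ≤ K := by
  rw [tendstoInMeasure_iff_measureReal_norm] at hg
  set V := μ.real {x | s < ‖g x‖} with hV
  -- Lowering the level by δ absorbs the error |u N - g| < δ; let N tend to infinity first, then δ
  -- to 0.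
  have key : ∀ δ : ℝ, 0 < δ → δ < s → (s - δ) * V ≤ K := by
    intro δ hδ hδs
    have hlim : Tendsto (fun N => K + (s - δ) * μ.real {x | δ ≤ ‖u N x - g x‖}) atTop
        (𝓝 (K + (s - δ) * 0)) := ((hg δ hδ).const_mul _).const_add _
    rw [mul_zero, add_zero] at hlim
    refine ge_of_tendsto hlim ?_
    filter_upwards [hu] with N hN
    have hsd : 0 < s - δ := by linarith
    have hincl : {x | s < ‖g x‖} ⊆ {x | s - δ < ‖u N x‖} ∪ {x | δ ≤ ‖u N x - g x‖} := by
      intro x hx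
      by_contra hcon
      simp only [Set.mem_union, Set.mem_ofPred_eq, not_or, not_lt, not_le] at hcon
      have hx : s < ‖g x‖ := hx
      have := norm_sub_norm_le (g x) (u N x)
      rw [norm_sub_rev] at this
      linarith [hcon.1, hcon.2]
    have h1 := mul_le_mul_of_nonneg_left
      ((measureReal_mono hincl).trans (measureReal_union_le (μ := μ) _ _)) hsd.le
    linarith [hN (s - δ) hsd]
  have hlim : Tendsto (fun δ : ℝ => (s - δ) * V) (𝓝[>] 0) (𝓝 ((s - 0) * V)) :=
    ((continuous_const.sub continuous_id).mul continuous_const).continuousWithinAt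
  rw [sub_zero] at hlim
  refine le_of_tendsto hlim ?_
  filter_upwards [Ioo_mem_nhdsGT hs] with δ hδ
  exact key δ hδ.1 hδ.2

/-! ### The main theorem: passage to the limit. -/

theorem mainTheorem4 (m : ℝ → ℂ) (hm : IsMarcinkiewiczMultiplier m) :
    (∀ f : UnitAddCircle → ℂ, MemLp f 1 volume →
      IsMultiplierSeriesSum m f (multiplierOperator m f)) ∧
    (∃ C : ℝ≥0, ∀ f : UnitAddCircle → ℂ, MemLp f 1 volume →
      weakLpNorm (multiplierOperator m f) 1 ≤ C * eLpNorm f 1 volume) ∧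
    (∀ p : ℝ≥0∞, 1 < p → p < ⊤ →
      ∃ C : ℝ≥0, ∀ f : UnitAddCircle → ℂ, MemLp f p volume →
        MemLp (multiplierOperator m f) p volume ∧
        eLpNorm (multiplierOperator m f) p volume ≤ C * eLpNorm f p volume) := by
  obtain ⟨A, hA, ha⟩ := hm.exists_isDiscreteMarcinkiewicz
  have hconv : ∀ f : UnitAddCircle → ℂ, MemLp f 1 volume →
      IsMultiplierSeriesSum m f (multiplierOperator m f) := by
    intro f hf
    obtain ⟨g, hg, hlim⟩ := ha.exists_tendstoInMeasure_partialSum hA (memLp_one_iff_integrable.1 hf)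
    -- `multiplierPartialSum m f N` unfolds to `fourierMultiplier` on [-N, N] with the sampled
    -- coefficients, so the limit found above applies directly.
    have hex : ∃ g, IsMultiplierSeriesSum m f g := ⟨g, hg, hlim⟩
    rw [multiplierOperator, dif_pos hex]
    exact hex.choose_spec
  set W := 9 * weakTypeConst (2 * A) with hW
  have hW0 : 0 < W := by rw [hW, weakTypeConst]; positivity
  refine ⟨hconv, ⟨W.toNNReal, fun f hf => ?_⟩, fun p hp1 hp2 => ?_⟩
  · have hfi := memLp_one_iff_integrable.1 hf
    refine iSup₂_le fun s hs => ?_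
    have h := mul_measureReal_lt_norm_le_of_tendstoInMeasure (K := W * ∫ x, ‖f x‖)
      (by
        filter_upwards [eventually_ge_atTop 1] with N hN s hs
        exact ha.weak_type_partialSum hA hN hfi hs) (hconv f hf).tendsto
      (s := s) (by exact_mod_cast hs)
    have e : eLpNorm f 1 volume = ENNReal.ofReal (∫ x, ‖f x‖) := by
      rw [eLpNorm_one_eq_lintegral_enorm, ofReal_integral_norm_eq_lintegral_enorm hfi]
    have e2 : {x | s < ‖multiplierOperator m f x‖₊}
        = {x | (s : ℝ) < ‖multiplierOperator m f x‖} := by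
      ext x; exact NNReal.coe_lt_coe.symm
    rw [e, e2, div_one, ENNReal.rpow_one, ← ofReal_measureReal]
    calc (s : ℝ≥0∞) * ENNReal.ofReal (volume.real {x | (s : ℝ) < ‖multiplierOperator m f x‖})
        = ENNReal.ofReal (s * volume.real {x | (s : ℝ) < ‖multiplierOperator m f x‖}) := by
          rw [ENNReal.ofReal_mul s.coe_nonneg, ENNReal.ofReal_coe_nnreal]
      _ ≤ ENNReal.ofReal (W * ∫ x, ‖f x‖) := ENNReal.ofReal_le_ofReal h
      _ = _ := ENNReal.ofReal_mul hW0.le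
  · have hpr : 1 < p.toReal := by
      rw [← ENNReal.toReal_one]
      exact (ENNReal.toReal_lt_toReal ENNReal.one_ne_top hp2.ne).2 hp1
    have hpe : ENNReal.ofReal p.toReal = p := ENNReal.ofReal_toReal hp2.ne
    obtain ⟨C, hC⟩ := ha.exists_eLpNorm_partialSum_le hA hpr
    rw [hpe] at hC
    refine ⟨C, fun f hf => ?_⟩
    have hS := hconv f (hf.mono_exponent hp1.le)
    have hle : eLpNorm (multiplierOperator m f) p volume ≤ C * eLpNorm f p volume := by
      -- Fatou's lemma in measure form: a bound on the L^p norms valid for all large N is inherited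
      -- by the limit.
      refine eLpNorm_le_of_tendstoInMeasure (f := multiplierPartialSum m f) (u := atTop) ?_
        hS.tendsto fun N => (continuous_fourierMultiplier _ _ f).aestronglyMeasurable
      filter_upwards [eventually_ge_atTop 1] with N hN
      exact hC N hN f hf
    exact ⟨⟨hS.aestronglyMeasurable,
      hle.trans_lt (ENNReal.mul_lt_top ENNReal.coe_lt_top hf.2)⟩, hle⟩
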